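/- Let $p,q$ be integers and let $T_{p,q}\subset\mathbb R^3$ be the curve $$T_{p,q}=\{((2+\cos qt)\cos pt,\ (2+\cos qt)\sin pt,\ \sin qt) : t\in\mathbb R\}$$ on the boundary of the standard unknotted solid torus. Call two subsets of $\mathbb R^3$ equivalent if some homeomorphism of $\mathbb R^3$ onto itself carries one onto the other. A torus knot is a subset $K\subset\mathbb R^3$ equivalent to $T_{p,q}$ for some coprime integers $p,q$; it is nontrivial if it is not equivalent to the round unit circle in a plane. Then for every nontrivial torus knot $K$ and every base point $b\in\mathbb R^3\setminus K$, the knot group $G=\pi_1(\mathbb R^3\setminus K,b)$ contains a generalized torsion element: an element $x\neq 1$ for which there are $k\ge 1$ and $y_1,\dots,y_k\in G$ with $$(y_1^{-1}xy_1)(y_2^{-1}xy_2)\cdots(y_k^{-1}xy_k)=1.$$ -/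

import Mathlib

/-- An element `x` of a group is a generalized torsion element if `x ≠ 1` and some nonempty finite
product of conjugates `(y₁⁻¹ x y₁) (y₂⁻¹ x y₂) ⋯ (yₖ⁻¹ x yₖ)` of `x` is the identity. -/
def IsGeneralizedTorsion {G : Type*} [Group G] (x : G) : Prop :=
  x ≠ 1 ∧ ∃ l : List G, l ≠ [] ∧ (l.map fun y => y⁻¹ * x * y).prod = 1

/-- Euclidean three-space. -/
abbrev Space : Type := EuclideanSpace ℝ (Fin 3)

/-- Equivalence of knots: some homeomorphism of Euclidean three-space onto itself carries `K`
onto `L`. -/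
def KnotEquiv (K L : Set Space) : Prop :=
  ∃ h : Space ≃ₜ Space, h '' K = L

/-- The round unit circle in the horizontal coordinate plane. -/
def roundCircle : Set Space :=
  {x | x 0 ^ 2 + x 1 ^ 2 = 1 ∧ x 2 = 0}

/-- A knot is trivial if it is equivalent to the round circle. -/
def IsTrivialKnot (K : Set Space) : Prop :=
  KnotEquiv K roundCircle

/-- The curve of type `(p, q)` on the boundary of the standard (unknotted) solid torus
`(√(x² + y²) - 2)² + z² ≤ 1`: it winds `p` times around the axis of revolution (the `z`-axis) while it winds
`q` times around its core. For coprime `p`, `q` it is a simple closed curve. -/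
noncomputable def torusCurve (p q : ℤ) : Set Space :=
  Set.range fun t : ℝ =>
    (!₂[(2 + Real.cos (q * t)) * Real.cos (p * t),
        (2 + Real.cos (q * t)) * Real.sin (p * t),
        Real.sin (q * t)] : Space)

/-- A torus knot is a knot equivalent to the standard torus curve of type `(p, q)`, for some
coprime integers `p` and `q`. -/
def IsTorusKnot (K : Set Space) : Prop :=
  ∃ p q : ℤ, IsCoprime p q ∧ KnotEquiv K (torusCurve p q)

/-- The knot group of `K` at the base point `b`: the fundamental group of the complement of `K`. -/
abbrev KnotGroup (K : Set Space) (b : (Kᶜ : Set Space)) : Type :=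
  FundamentalGroup (Kᶜ : Set Space) b

open Topology

open Complex (I exp)

open Polynomial.Chebyshev (T U)

/-! If a ^ n commutes with b but a does not, the commutator of a and b is a generalized torsion
element: conjugates of it by powers of a multiply to the commutator of a ^ n and b, which is 1. For
the torus knot take a the core of the solid torus, b its meridian and n = p.

That a ^ p commutes with b (`commute_coreLoop_pow`): a curve on the torus parallel to the knot is
homotopic inside the solid torus to p times the core, while in a shell outside it lies in an abelian
group of translations that also contains b. No presentation of the knot group is needed, only loops
coming from two simply connected spaces.

That a and b do not commute (`not_commute_coreLoop_meridianLoop`): direction and rotated meridian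
coordinate map the complement of the knot to the complement of u ^ q + v ^ p = 0 in ℂ². Its infinite
cyclic covering, given by log (u ^ q + v ^ p), projects to the Milnor fibre u ^ q + v ^ p = 1, with
spine the complete bipartite graph u ^ q = h, v ^ p = 1 - h, 0 ≤ h ≤ 1. Lifts of a stay near
vertices h = 1, lifts of b near vertices h = 0. The lifts of the two products from edge 0 run over
the edges 0, p, p + q and 0, q, p + q, so together they bound a 4-cycle. When p, q ≠ 1 this cycle
uses edge 0 once, and a function winding once along that edge separates their end points in a
further logarithmic covering.

Finally p = 1 or q = 1 gives the unknot by explicit homeomorphisms, and signs are removed by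
reversal and reflection. -/

namespace IsGeneralizedTorsion

/-! ### Generalized torsion from commutators. -/

theorem map_injective {G H F : Type*} [Group G] [Group H] [FunLike F G H] [MonoidHomClass F G H]
    (f : F) (hf : Function.Injective f) {x : G} (hx : IsGeneralizedTorsion x) :
    IsGeneralizedTorsion (f x) := by
  obtain ⟨h1, l, hl, hp⟩ := hx
  refine ⟨fun h => h1 (hf (by simpa using h)), l.map f, by simpa using hl, ?_⟩
  rw [← map_one f, ← hp, map_list_prod, List.map_map, List.map_map]
  congr 1
  refine List.map_congr_left fun y _ => ?_
  simp

/-- Telescoping: the commutator of a ^ (n + 1) and b is the conjugate a ^ n [a, b] a ^ (-n) times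
the commutator of a ^ n and b. The list is reversed so that the highest power comes first. -/
theorem exists_list_prod_commutator {G : Type*} [Group G] (a b : G) (n : ℕ) :
    (((List.range n).reverse.map fun i => (a ^ i)⁻¹).map
      fun y => y⁻¹ * (a * b * a⁻¹ * b⁻¹) * y).prod = a ^ n * b * (a ^ n)⁻¹ * b⁻¹ := by
  induction n with
  | zero => simp
  | succ n ih =>
    rw [List.range_succ, List.reverse_append, List.map_append, List.map_append, List.prod_append,
      ih]
    simp [pow_succ, mul_assoc]

theorem exists_of_commute_pow {G : Type*} [Group G] {a b : G} {n : ℕ} (hn : n ≠ 0)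
    (hc : Commute (a ^ n) b) (hab : ¬ Commute a b) : ∃ x : G, IsGeneralizedTorsion x := by
  refine ⟨a * b * a⁻¹ * b⁻¹, fun h => hab ?_, _, ?_, exists_list_prod_commutator a b n |>.trans ?_⟩
  · rwa [mul_inv_eq_one, mul_inv_eq_iff_eq_mul] at h
  · simpa using hn
  · rw [mul_inv_eq_one, mul_inv_eq_iff_eq_mul]
    exact hc

end IsGeneralizedTorsion

/-! ### Invariance under homeomorphisms of space. -/

/-- The isomorphism of fundamental groups induced by a homeomorphism. -/
noncomputable def fundamentalGroupMulEquivOfHomeomorph {X Y : Type} [TopologicalSpace X]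
    [TopologicalSpace Y] (h : X ≃ₜ Y) (x : X) : FundamentalGroup X x ≃* FundamentalGroup Y (h x) :=
  (FundamentalGroupoidFunctor.equivOfHomotopyEquiv
    h.toHomotopyEquiv).fullyFaithfulFunctor.mulEquivEnd (FundamentalGroupoid.mk x)

namespace KnotEquiv

theorem refl (K : Set Space) : KnotEquiv K K := ⟨Homeomorph.refl _, Set.image_id K⟩

theorem trans {K L M : Set Space} : KnotEquiv K L → KnotEquiv L M → KnotEquiv K M := by
  rintro ⟨h, rfl⟩ ⟨k, rfl⟩
  exact ⟨h.trans k, Set.image_comp k h K⟩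

theorem exists_isGeneralizedTorsion {K L : Set Space} (h : KnotEquiv K L)
    (hL : ∀ b : (Lᶜ : Set Space), ∃ x : KnotGroup L b, IsGeneralizedTorsion x)
    (b : (Kᶜ : Set Space)) : ∃ x : KnotGroup K b, IsGeneralizedTorsion x := by
  obtain ⟨h, rfl⟩ := h
  let e : (Kᶜ : Set Space) ≃ₜ ((h '' K)ᶜ : Set Space) :=
    (h.image Kᶜ).trans (Homeomorph.setCongr (Set.image_compl_eq h.bijective))
  obtain ⟨x, hx⟩ := hL (e b)
  exact ⟨_, hx.map_injective (fundamentalGroupMulEquivOfHomeomorph e b).symm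
    (MulEquiv.injective _)⟩

end KnotEquiv

/-! ### Logarithmic coverings. -/

/-- The infinite cyclic covering of `Y` on which the nowhere vanishing function `F` has a
logarithm. -/
def LogCover {Y : Type*} (F : Y → ℂ) : Type _ := {z : Y × ℂ // Complex.exp z.2 = F z.1}

namespace LogCover

variable {Y : Type*} {F : Y → ℂ}

/-- The covering projection. -/
def proj (z : LogCover F) : Y := z.1.1

/-- The logarithm of `F` on its logarithmic covering. -/
def log (z : LogCover F) : ℂ := z.1.2

@[simp] theorem exp_log (z : LogCover F) : Complex.exp z.log = F z.proj := z.2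

theorem apply_proj_ne_zero (z : LogCover F) : F z.proj ≠ 0 :=
  exp_log z ▸ Complex.exp_ne_zero _

theorem ext {z z' : LogCover F} (h : z.proj = z'.proj) (h' : z.log = z'.log) : z = z' :=
  Subtype.ext (Prod.ext h h')

variable [TopologicalSpace Y]

instance : TopologicalSpace (LogCover F) :=
  inferInstanceAs (TopologicalSpace {z : Y × ℂ // Complex.exp z.2 = F z.1})

@[fun_prop] theorem continuous_proj : Continuous (proj : LogCover F → Y) :=
  continuous_fst.comp continuous_subtype_val

@[fun_prop] theorem continuous_log : Continuous (log : LogCover F → ℂ) :=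
  continuous_snd.comp continuous_subtype_val

theorem isEvenlyCovered (hF : Continuous F) {y₀ : Y} (h₀ : F y₀ ≠ 0) :
    IsEvenlyCovered (proj : LogCover F → Y) y₀ ℤ := by
  have h2 : (2 * Real.pi * Complex.I : ℂ) ≠ 0 := Complex.two_pi_I_ne_zero
  -- On this neighbourhood the principal logarithm of F y / F y₀ is continuous, which gives a local
  -- branch L of log F. The sheets are its translates by 2πi times an integer.
  set U : Set Y := {y | F y / F y₀ ∈ Complex.slitPlane} with hU
  have hUo : IsOpen U := Complex.isOpen_slitPlane.preimage (hF.div_const _)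
  obtain ⟨L, hLc, hLe⟩ : ∃ L : Y → ℂ, ContinuousOn L U ∧ ∀ y ∈ U, Complex.exp (L y) = F y := by
    refine ⟨fun y => Complex.log (F y₀) + Complex.log (F y / F y₀), continuousOn_const.add
      (ContinuousOn.clog ((hF.div_const _).continuousOn) fun y hy => hy), fun y hy => ?_⟩
    rw [Complex.exp_add, Complex.exp_log h₀, Complex.exp_log (Complex.slitPlane_ne_zero hy),
      mul_div_cancel₀ _ h₀]
  have hint : ∀ z : LogCover F, z.proj ∈ U →
      ∃ n : ℤ, z.log = L z.proj + n * (2 * Real.pi * Complex.I) := fun z hz =>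
    Complex.exp_eq_exp_iff_exists_int.1 (by rw [exp_log, hLe _ hz])
  choose n hn using fun z : proj (F := F) ⁻¹' U => hint z.1 z.2
  have hLU : Continuous fun y : U => L y := hLc.domRestrict
  -- The sheet number is integer valued and equals a continuous real function, hence is continuous
  -- into the discrete integers.
  have hnc : Continuous n := by
    rw [Int.isClosedEmbedding_coe_real.isInducing.continuous_iff]
    have : ((fun k : ℤ => (k : ℝ)) ∘ n) = fun z : proj (F := F) ⁻¹' U =>
        ((z.1.log - L z.1.proj) / (2 * Real.pi * Complex.I)).re := by
      funext z
      have h3 : z.1.log - L z.1.proj = n z * (2 * Real.pi * Complex.I) :=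
        sub_eq_iff_eq_add'.2 (hn z)
      rw [h3, mul_div_cancel_right₀ _ h2, Function.comp_apply, Complex.intCast_re]
    rw [this]
    have h3 : Continuous fun z : proj (F := F) ⁻¹' U => L z.1.proj :=
      hLU.comp (continuous_proj.comp continuous_subtype_val |>.subtype_mk fun z => z.2)
    exact Complex.continuous_re.comp
      (((continuous_log.comp continuous_subtype_val).sub h3).div_const _)
  refine ⟨inferInstance, U, ?_, hUo, hUo.preimage continuous_proj,
    { toFun := fun z => (⟨z.1.proj, z.2⟩, n z)
      invFun := fun w => ⟨⟨(w.1, L w.1 + w.2 * (2 * Real.pi * Complex.I)), ?_⟩, w.1.2⟩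
      left_inv := fun z => ?_
      right_inv := fun w => ?_
      continuous_toFun := ?_
      continuous_invFun := ?_ }, fun _ => rfl⟩
  · simp [hU, div_self h₀]
  · simp [Complex.exp_add, Complex.exp_int_mul_two_pi_mul_I, hLe _ w.1.2]
  · exact Subtype.ext (ext rfl (hn z).symm)
  · refine Prod.ext rfl ?_
    have := hn ⟨⟨(w.1, L w.1 + w.2 * (2 * Real.pi * Complex.I)), by
      simp [Complex.exp_add, Complex.exp_int_mul_two_pi_mul_I, hLe _ w.1.2]⟩, w.1.2⟩
    have h4 := mul_right_cancel₀ h2 (add_left_cancel this)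
    exact_mod_cast h4.symm
  · exact ((continuous_proj.comp continuous_subtype_val).subtype_mk _).prodMk hnc
  · refine Continuous.subtype_mk (Continuous.subtype_mk ?_ _) _
    have h5 : Continuous fun w : U × ℤ => L w.1 := hLU.comp continuous_fst
    have h6 : Continuous fun w : U × ℤ => (w.2 : ℂ) :=
      (continuous_of_discreteTopology (f := fun k : ℤ => (k : ℂ))).comp continuous_snd
    exact (continuous_subtype_val.comp continuous_fst).prodMk (h5.add (h6.mul_const _))

theorem isCoveringMap (hF : Continuous F) (h₀ : ∀ y, F y ≠ 0) :
    IsCoveringMap (proj : LogCover F → Y) :=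
  fun y => (isEvenlyCovered hF (h₀ y)).to_isEvenlyCovered_preimage

/-- The end point of the lift of a path to an iterated logarithmic covering depends only on its
homotopy class. -/
theorem eq_of_homotopic {G : LogCover F → ℂ} (hF : Continuous F) (hF₀ : ∀ y, F y ≠ 0)
    (hG : Continuous G) (hG₀ : ∀ y, G y ≠ 0) {x y : Y} {γ γ' : Path x y} (h : γ.Homotopic γ')
    {e₀ e₁ e₁' : LogCover G} (Γ : Path e₀ e₁) (Γ' : Path e₀ e₁')
    (hΓ : ∀ t, (Γ t).proj.proj = γ t) (hΓ' : ∀ t, (Γ' t).proj.proj = γ' t) : e₁ = e₁' := by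
  have key : (Γ : C(unitInterval, LogCover G)).HomotopicRel Γ' {0, 1} := by
    -- Both lifts start at `e₀`, so a homotopy rel end points downstairs lifts through the two
    -- coverings in turn.
    rw [(isCoveringMap hG hG₀).homotopicRel_iff_comp ⟨0, by simp, by simp⟩,
      (isCoveringMap hF hF₀).homotopicRel_iff_comp ⟨0, by simp, by simp⟩]
    have h1 : (γ : C(unitInterval, Y)).HomotopicRel γ' {0, 1} := h
    convert! h1 using 1
    · ext t; exact hΓ t
    · ext t; exact hΓ' t
  obtain ⟨H⟩ := key
  have h1 := H.eq_fst 0 (x := 1) (by simp)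
  have h2 := H.eq_snd 0 (x := 1) (by simp)
  simpa using h1.symm.trans h2

end LogCover

/-! ### Loops from simply connected spaces with symmetries. -/

theorem apply_iterate_eq {S X : Type} [TopologicalSpace S] [TopologicalSpace X] {x : X}
    (f : C(S, X)) (T : C(S, S)) (hT : ∀ s, f (T s) = f s) {s : S}
    (hs : f s = x) (n : ℕ) : f (T^[n] s) = x := by
  induction n with
  | zero => exact hs
  | succ n ih => rw [Function.iterate_succ_apply', hT, ih]

section SimplyConnectedLoop

variable {S S' X : Type} [TopologicalSpace S] [SimplyConnectedSpace S] [TopologicalSpace S']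
  [SimplyConnectedSpace S'] [TopologicalSpace X] {x : X}

/-- The class of the image of any path from `s` to `s'` in a simply connected space, when both end
points have the same image. -/
noncomputable def simplyConnectedLoop (f : C(S, X)) {s s' : S} (hs : f s = x) (hs' : f s' = x) :
    FundamentalGroup X x :=
  FundamentalGroup.fromPath
    (Path.Homotopic.Quotient.mk (((PathConnectedSpace.somePath s s').map f.continuous).cast
      hs.symm hs'.symm))

/-- All paths with given end points in S are homotopic, so any convenient path computes the class.
-/
theorem simplyConnectedLoop_eq (f : C(S, X)) {s s' : S} (hs : f s = x) (hs' : f s' = x)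
    (γ : Path s s') (δ : Path x x) (h : ∀ t, δ t = f (γ t)) :
    simplyConnectedLoop f hs hs' = FundamentalGroup.fromPath (Path.Homotopic.Quotient.mk δ) := by
  subst hs
  obtain rfl : δ = (γ.map f.continuous).cast rfl hs'.symm := by
    ext t
    exact h t
  have h1 : ((PathConnectedSpace.somePath s s').map f.continuous).Homotopic
      (γ.map f.continuous) := (SimplyConnectedSpace.paths_homotopic _ _).map f
  obtain ⟨H⟩ := h1
  exact Quotient.sound ⟨H.cast rfl rfl⟩

/-- In this group the right factor is the path traversed first. -/
theorem simplyConnectedLoop_mul (f : C(S, X)) {s s' s'' : S} (hs : f s = x) (hs' : f s' = x)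
    (hs'' : f s'' = x) : simplyConnectedLoop f hs' hs'' * simplyConnectedLoop f hs hs' =
      simplyConnectedLoop f hs hs'' := by
  rw [simplyConnectedLoop_eq f hs hs''
    ((PathConnectedSpace.somePath s s').trans (PathConnectedSpace.somePath s' s''))
    ((((PathConnectedSpace.somePath s s').map f.continuous).cast hs.symm hs'.symm).trans
      (((PathConnectedSpace.somePath s' s'').map f.continuous).cast hs'.symm hs''.symm))]
  · rfl
  · intro t
    simp only [Path.trans_apply]
    split_ifs <;> rfl

theorem simplyConnectedLoop_self (f : C(S, X)) {s : S} (hs hs' : f s = x) :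
    simplyConnectedLoop f hs hs' = 1 := by
  rw [simplyConnectedLoop_eq f hs hs' (Path.refl s) (Path.refl x) fun t => by simpa using hs.symm]
  rfl

theorem simplyConnectedLoop_map (f : C(S, X)) (T : C(S, S)) (hT : ∀ s, f (T s) = f s) {s s' : S}
    (hs : f s = x) (hs' : f s' = x) :
    simplyConnectedLoop f ((hT s).trans hs) ((hT s').trans hs') = simplyConnectedLoop f hs hs' :=
  simplyConnectedLoop_eq f _ _ ((PathConnectedSpace.somePath s s').map T.continuous)
    (((PathConnectedSpace.somePath s s').map f.continuous).cast hs.symm hs'.symm)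
    fun _ => (hT _).symm

theorem simplyConnectedLoop_pow (f : C(S, X)) (T : C(S, S)) (hT : ∀ s, f (T s) = f s) {s : S}
    (hs : f s = x) (n : ℕ) :
    simplyConnectedLoop f hs ((hT s).trans hs) ^ n =
      simplyConnectedLoop f hs (apply_iterate_eq f T hT hs n) := by
  induction n with
  | zero => exact (simplyConnectedLoop_self f _ _).symm
  | succ n ih =>
    rw [pow_succ, ih, ← simplyConnectedLoop_map f T hT hs (apply_iterate_eq f T hT hs n),
      simplyConnectedLoop_mul]
    congr 1
    rw [Function.iterate_succ_apply']

/-- Each product is the class of a path from s to T (T' s) = T' (T s), after one factor has been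
translated by a symmetry. -/
theorem commute_simplyConnectedLoop (f : C(S, X)) (T T' : C(S, S)) (hT : ∀ s, f (T s) = f s)
    (hT' : ∀ s, f (T' s) = f s) {s : S} (hs : f s = x) (hTT : T (T' s) = T' (T s)) :
    Commute (simplyConnectedLoop f hs ((hT s).trans hs))
      (simplyConnectedLoop f hs ((hT' s).trans hs)) := by
  rw [commute_iff_eq]
  nth_rw 1 [← simplyConnectedLoop_map f T' hT' hs ((hT s).trans hs)]
  nth_rw 2 [← simplyConnectedLoop_map f T hT hs ((hT' s).trans hs)]
  rw [simplyConnectedLoop_mul, simplyConnectedLoop_mul]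
  congr 1
  exact hTT.symm

/-- The paths γ and γ' have the same image in X, so the n-th power of the loop of T is also the loop
of `T₂`, and `T₁`, `T₂` commute at the base point. This glues information from two pieces of X
without van Kampen. -/
theorem commute_simplyConnectedLoop_pow (f : C(S, X)) (T : C(S, S)) (hT : ∀ s, f (T s) = f s)
    {s : S} (hs : f s = x) (n : ℕ) (f' : C(S', X)) (T₁ T₂ : C(S', S'))
    (hT₁ : ∀ s, f' (T₁ s) = f' s) (hT₂ : ∀ s, f' (T₂ s) = f' s) {s' : S'} (hs' : f' s' = x)
    (hTT : T₂ (T₁ s') = T₁ (T₂ s')) (γ : Path s (T^[n] s)) (γ' : Path s' (T₂ s'))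
    (hγ : ∀ t, f (γ t) = f' (γ' t)) :
    Commute (simplyConnectedLoop f hs ((hT s).trans hs) ^ n)
      (simplyConnectedLoop f' hs' ((hT₁ s').trans hs')) := by
  rw [simplyConnectedLoop_pow f T hT, simplyConnectedLoop_eq f hs _ γ
    ((γ'.map f'.continuous).cast hs'.symm ((hT₂ s').trans hs').symm) fun t => (hγ t).symm,
    ← simplyConnectedLoop_eq f' hs' ((hT₂ s').trans hs') γ' _ fun t => rfl]
  exact commute_simplyConnectedLoop f' T₂ T₁ hT₂ hT₁ hs' hTT

end SimplyConnectedLoop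

/-! ### Toroidal coordinates and the equation of the knot. -/

/-- The horizontal part of a point of space, as a complex number. -/
def horizontal (x : Space) : ℂ := ⟨x 0, x 1⟩

/-- The position relative to the core of the solid torus, in the meridian half-plane. -/
noncomputable def meridian (x : Space) : ℂ := ⟨‖horizontal x‖ - 2, x 2⟩

/-- The horizontal direction, damped near the axis of revolution. -/
noncomputable def direction (x : Space) : ℂ := horizontal x / (max 1 ‖horizontal x‖ : ℝ)

/-- The point with direction `e` and meridian coordinate `v`. -/
noncomputable def revolve (e v : ℂ) : Space := !₂[(2 + v.re) * e.re, (2 + v.re) * e.im, v.im]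

@[fun_prop] theorem continuous_horizontal : Continuous horizontal := by
  have : horizontal = fun x : Space => (x 0 : ℂ) + (x 1 : ℂ) * I := by
    funext x
    apply Complex.ext <;> simp [horizontal]
  rw [this]
  fun_prop

@[fun_prop] theorem continuous_meridian : Continuous meridian := by
  have : meridian = fun x : Space => ((‖horizontal x‖ - 2 : ℝ) : ℂ) + (x 2 : ℂ) * I := by
    funext x
    apply Complex.ext <;> simp [meridian]
  rw [this]
  fun_prop

theorem max_one_norm_ne_zero (x : Space) : ((max 1 ‖horizontal x‖ : ℝ) : ℂ) ≠ 0 := by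
  exact_mod_cast (lt_of_lt_of_le one_pos (le_max_left _ _)).ne'

@[fun_prop] theorem continuous_direction : Continuous direction := by
  refine continuous_horizontal.div (Complex.continuous_ofReal.comp ?_) max_one_norm_ne_zero
  fun_prop

@[fun_prop] theorem Continuous.revolve {α : Type*} [TopologicalSpace α] {e v : α → ℂ}
    (he : Continuous e) (hv : Continuous v) : Continuous fun a => revolve (e a) (v a) := by
  refine (PiLp.continuous_toLp 2 _).comp (continuous_pi fun i => ?_)
  fin_cases i
  · exact (continuous_const.add (Complex.continuous_re.comp hv)).mul (Complex.continuous_re.comp he)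
  · exact (continuous_const.add (Complex.continuous_re.comp hv)).mul (Complex.continuous_im.comp he)
  · exact Complex.continuous_im.comp hv

@[simp] theorem horizontal_revolve (e v : ℂ) : horizontal (revolve e v) = (2 + v.re : ℝ) * e := by
  apply Complex.ext <;> simp [horizontal, revolve]

theorem norm_horizontal_revolve {e v : ℂ} (he : ‖e‖ = 1) (hv : -2 ≤ v.re) :
    ‖horizontal (revolve e v)‖ = 2 + v.re := by
  rw [horizontal_revolve, norm_mul, he, mul_one, Complex.norm_real, Real.norm_of_nonneg]
  linarith

theorem meridian_revolve {e v : ℂ} (he : ‖e‖ = 1) (hv : -2 ≤ v.re) :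
    meridian (revolve e v) = v := by
  apply Complex.ext
  · change ‖horizontal (revolve e v)‖ - 2 = v.re
    rw [norm_horizontal_revolve he hv, add_sub_cancel_left]
  · simp [meridian, revolve]

theorem direction_revolve {e v : ℂ} (he : ‖e‖ = 1) (hv : -1 ≤ v.re) :
    direction (revolve e v) = e := by
  rw [direction, norm_horizontal_revolve he (by linarith), max_eq_right (by linarith),
    horizontal_revolve, mul_div_cancel_left₀]
  exact_mod_cast (by linarith : (2 + v.re) ≠ 0)

theorem norm_direction_le (x : Space) : ‖direction x‖ ≤ 1 := by
  rw [direction, norm_div, Complex.norm_real, Real.norm_of_nonneg (by positivity)]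
  exact div_le_one_of_le₀ (le_max_right _ _) (by positivity)

theorem one_le_norm_horizontal {x : Space} (h : ‖meridian x‖ ≤ 1) : 1 ≤ ‖horizontal x‖ := by
  have := (abs_le.1 ((Complex.abs_re_le_norm (meridian x)).trans h)).1
  simp only [meridian] at this
  linarith

theorem norm_direction {x : Space} (h : 1 ≤ ‖horizontal x‖) : ‖direction x‖ = 1 := by
  rw [direction, norm_div, Complex.norm_real, Real.norm_of_nonneg (by positivity),
    max_eq_right h, div_self (by linarith)]

theorem revolve_direction_meridian {x : Space} (h : 1 ≤ ‖horizontal x‖) :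
    revolve (direction x) (meridian x) = x := by
  have h1 : direction x = ((‖horizontal x‖⁻¹ : ℝ) : ℂ) * horizontal x := by
    rw [direction, max_eq_right h, div_eq_inv_mul, Complex.ofReal_inv]
  have h2 : ‖horizontal x‖ ≠ 0 := by linarith
  ext i
  fin_cases i <;>
  simp [revolve, h1, meridian, horizontal] at h2 ⊢ <;> field_simp

theorem revolve_exp (a b : ℝ) : revolve (exp (a * I)) (exp (b * I)) =
    !₂[(2 + Real.cos b) * Real.cos a, (2 + Real.cos b) * Real.sin a, Real.sin b] := by
  simp only [revolve, Complex.exp_ofReal_mul_I_re, Complex.exp_ofReal_mul_I_im]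

theorem torusCurve_eq (p q : ℤ) : torusCurve p q =
    Set.range fun t : ℝ => revolve (exp ((p * t : ℝ) * I)) (exp ((q * t : ℝ) * I)) := by
  simp only [revolve_exp, torusCurve]

theorem neg_one_le_re_of_norm_le {v : ℂ} (h : ‖v‖ ≤ 1) : -1 ≤ v.re :=
  (abs_le.1 ((Complex.abs_re_le_norm v).trans h)).1

section

variable {p q : ℕ}

theorem direction_pow_eq_of_mem {x : Space} (hx : x ∈ torusCurve p q) :
    direction x ^ q = meridian x ^ p := by
  rw [torusCurve_eq] at hx
  obtain ⟨t, rfl⟩ := hx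
  have h1 := neg_one_le_re_of_norm_le (Complex.norm_exp_ofReal_mul_I ((q : ℤ) * t)).le
  dsimp only
  rw [meridian_revolve (Complex.norm_exp_ofReal_mul_I _) (by linarith),
    direction_revolve (Complex.norm_exp_ofReal_mul_I _) h1, ← Complex.exp_nat_mul,
    ← Complex.exp_nat_mul]
  congr 1
  push_cast
  ring

/-- Since the direction has norm at most 1, the equation confines x to the solid torus, where the
direction has norm exactly 1; hence x lies on the boundary torus. Bézout then supplies the
parameter. -/
theorem mem_torusCurve_of_pow_eq (hpq : IsCoprime (p : ℤ) q) (hp : p ≠ 0) {x : Space}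
    (h : direction x ^ q = meridian x ^ p) : x ∈ torusCurve p q := by
  have h1 : ‖meridian x‖ ≤ 1 := by
    rw [← pow_le_one_iff_of_nonneg (norm_nonneg _) hp, ← norm_pow, ← h, norm_pow]
    exact pow_le_one₀ (norm_nonneg _) (norm_direction_le x)
  have h2 := one_le_norm_horizontal h1
  have h3 := norm_direction h2
  have h4 : ‖meridian x‖ = 1 := by
    rw [← pow_eq_one_iff_of_nonneg (norm_nonneg _) hp, ← norm_pow, ← h, norm_pow, h3, one_pow]
  have hd : direction x ≠ 0 := norm_ne_zero_iff.1 (by rw [h3]; exact one_ne_zero)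
  have hm : meridian x ≠ 0 := norm_ne_zero_iff.1 (by rw [h4]; exact one_ne_zero)
  obtain ⟨r, s, hrs⟩ := hpq
  -- With r p + s q = 1, this l is a common root: l ^ p is the direction and l ^ q the meridian
  -- coordinate.
  set l : ℂ := direction x ^ r * meridian x ^ s with hl
  have hlp : l ^ p = direction x := by
    have : (meridian x ^ s) ^ p = direction x ^ (s * q) := by
      rw [← zpow_natCast, zpow_comm, zpow_natCast, ← h, mul_comm, zpow_mul, zpow_natCast]
    rw [hl, mul_pow, this, ← zpow_natCast, ← zpow_mul, ← zpow_add₀ hd, hrs, zpow_one]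
  have hlq : l ^ q = meridian x := by
    have : (direction x ^ r) ^ q = meridian x ^ (r * p) := by
      rw [← zpow_natCast, zpow_comm, zpow_natCast, h, mul_comm, zpow_mul, zpow_natCast]
    rw [hl, mul_pow, this, ← zpow_natCast, ← zpow_mul, ← zpow_add₀ hm, hrs, zpow_one]
  have hln : ‖l‖ = 1 := by simp [hl, norm_zpow, h3, h4]
  have hle : exp (Complex.arg l * I) = l := by
    simpa [hln] using Complex.norm_mul_exp_arg_mul_I l
  rw [torusCurve_eq]
  refine ⟨Complex.arg l, ?_⟩
  dsimp only
  have e1 : ∀ n : ℕ, exp ((((n : ℤ) : ℝ) * Complex.arg l : ℝ) * I) = l ^ n := fun n => by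
    nth_rw 2 [← hle]
    rw [← Complex.exp_nat_mul]
    congr 1
    push_cast
    ring
  rw [e1, e1, hlp, hlq, revolve_direction_meridian h2]

end

/-! ### The solid torus and the outer shell, unrolled. -/

section Regions

/-- A primitive `2p`-th root of unity. -/
noncomputable def halfRoot (p : ℕ) : ℂ := exp ((Real.pi / p : ℝ) * I)

theorem norm_halfRoot (p : ℕ) : ‖halfRoot p‖ = 1 := Complex.norm_exp_ofReal_mul_I _

theorem halfRoot_ne_zero (p : ℕ) : halfRoot p ≠ 0 := Complex.exp_ne_zero _

theorem halfRoot_pow (p : ℕ) [NeZero p] : halfRoot p ^ p = -1 := by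
  rw [halfRoot, ← Complex.exp_nat_mul, ← Complex.exp_pi_mul_I]
  congr 1
  have : (p : ℂ) ≠ 0 := Nat.cast_ne_zero.2 (NeZero.ne p)
  push_cast
  field_simp

/-- The universal covering of the part of the knot complement inside the solid torus. -/
def InnerCover (p q : ℕ) : Set (ℝ × ℂ) :=
  {s | ‖s.2‖ ≤ 1 ∧ exp (s.1 * I) ^ q + s.2 ^ p ≠ 0}

/-- The universal covering of the part of the knot complement outside the solid torus, but close to
it. -/
def OuterCover (p q : ℕ) : Set (ℝ × ℝ × ℝ) :=
  {s | 1 ≤ s.2.2 ∧ s.2.2 < 2 ∧ (s.2.2 = 1 → exp (s.1 * I) ^ q + exp (s.2.1 * I) ^ p ≠ 0)}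

theorem add_ne_zero_of_norm_lt {a b : ℂ} (h : ‖b‖ < ‖a‖) : a + b ≠ 0 := fun h' => by
  rw [eq_neg_of_add_eq_zero_left h', norm_neg] at h
  exact h.false

theorem exp_two_pi_shift (a : ℝ) (n : ℤ) : exp (((a + 2 * Real.pi * n : ℝ) : ℂ) * I) =
    exp (a * I) := by
  rw [Complex.exp_eq_exp_iff_exists_int]
  exact ⟨n, by push_cast; ring⟩

variable {p q : ℕ}

/-- A segment to a centre with m = 3/2 leaves the boundary m = 1 at once, and only there are points
removed. -/
theorem starConvex_outerCover : StarConvex ℝ ((0, 0, 3 / 2) : ℝ × ℝ × ℝ) (OuterCover p q) := by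
  rintro ⟨a, b, m⟩ ⟨h1, h2, h3⟩ c d hc hd hcd
  simp only [OuterCover, Set.mem_ofPred_eq, Prod.smul_mk, Prod.mk_add_mk, smul_eq_mul, mul_zero,
    zero_add] at h1 h2 h3 ⊢
  obtain rfl : c = 1 - d := by linarith
  refine ⟨by nlinarith, by nlinarith, fun h => ?_⟩
  obtain rfl : d = 1 := by
    rcases (by linarith : d ≤ 1).eq_or_lt with h4 | h4
    · exact h4
    · nlinarith
  simpa using h3 (by linarith)

theorem notMem_torusCurve {x : Space} (h : direction x ^ q ≠ meridian x ^ p) :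
    x ∉ torusCurve p q := fun h' => h (direction_pow_eq_of_mem h')

theorem innerCover_re {s : ℝ × ℂ} (hs : s ∈ InnerCover p q) : -1 ≤ (halfRoot p * s.2).re :=
  neg_one_le_re_of_norm_le (by rw [norm_mul, norm_halfRoot, one_mul]; exact hs.1)

/-- The point on the given meridian, in polar coordinates. -/
noncomputable def polar (b m : ℝ) : ℂ := m * exp (b * I)

@[fun_prop] theorem Continuous.polar {α : Type*} [TopologicalSpace α] {b m : α → ℝ}
    (hb : Continuous b) (hm : Continuous m) : Continuous fun a => polar (b a) (m a) := by
  unfold _root_.polar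
  fun_prop

theorem norm_polar {b m : ℝ} (hm : 0 ≤ m) : ‖polar b m‖ = m := by
  rw [polar, norm_mul, Complex.norm_exp_ofReal_mul_I, Complex.norm_real, Real.norm_of_nonneg hm,
    mul_one]

theorem outerCover_norm {s : ℝ × ℝ × ℝ} (hs : s ∈ OuterCover p q) :
    ‖halfRoot p * polar s.2.1 s.2.2‖ = s.2.2 := by
  rw [norm_mul, norm_halfRoot, one_mul, norm_polar (zero_le_one.trans hs.1)]

theorem outerCover_re {s : ℝ × ℝ × ℝ} (hs : s ∈ OuterCover p q) :
    -2 ≤ (halfRoot p * polar s.2.1 s.2.2).re :=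
  (abs_le.1 ((Complex.abs_re_le_norm _).trans ((outerCover_norm hs).trans_le hs.2.1.le))).1

/-- Along this curve, parallel to the knot, the two powers are equal instead of opposite. -/
theorem fiber_ne_zero (t : ℝ) :
    exp ((2 * Real.pi * p * t : ℝ) * I) ^ q + exp ((2 * Real.pi * q * t : ℝ) * I) ^ p ≠ 0 := by
  have : exp ((2 * Real.pi * p * t : ℝ) * I) ^ q = exp ((2 * Real.pi * q * t : ℝ) * I) ^ p := by
    rw [← Complex.exp_nat_mul, ← Complex.exp_nat_mul]
    congr 1
    push_cast
    ring
  rw [this, ← two_mul]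
  exact mul_ne_zero two_ne_zero (pow_ne_zero _ (Complex.exp_ne_zero _))

/-- Going once around the core of the solid torus. -/
noncomputable def innerShift : C(InnerCover p q, InnerCover p q) where
  toFun s := ⟨(s.1.1 + 2 * Real.pi * (1 : ℤ), s.1.2), s.2.1, by
    dsimp only
    rw [exp_two_pi_shift]
    exact s.2.2⟩
  continuous_toFun := by
    refine Continuous.subtype_mk ?_ _
    fun_prop

theorem innerShift_iterate (s : InnerCover p q) (n : ℕ) :
    (innerShift^[n] s : ℝ × ℂ) = (s.1.1 + 2 * Real.pi * n, s.1.2) := by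
  induction n with
  | zero => simp
  | succ n ih =>
    rw [Function.iterate_succ_apply']
    have h : ∀ s : InnerCover p q, (innerShift s : ℝ × ℂ) =
        (s.1.1 + 2 * Real.pi * (1 : ℤ), s.1.2) := fun _ => rfl
    rw [h, ih]
    push_cast
    ring_nf

variable [NeZero p]

/-- Shrinking moves v into the open disc, where |v ^ p| < 1 rules out cancellation with a number of
modulus 1. -/
theorem starConvex_innerCover : StarConvex ℝ (0 : ℝ × ℂ) (InnerCover p q) := by
  rw [starConvex_zero_iff]
  rintro ⟨a, v⟩ ⟨h1, h2⟩ t ht ht1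
  simp only [InnerCover, Set.mem_ofPred_eq, Prod.smul_mk] at h1 h2 ⊢
  have h3 : ‖t • v‖ ≤ t := by
    rw [norm_smul, Real.norm_of_nonneg ht]
    exact mul_le_of_le_one_right ht h1
  refine ⟨h3.trans ht1, ?_⟩
  rcases ht1.eq_or_lt with rfl | h4
  · simpa using h2
  · refine add_ne_zero_of_norm_lt ?_
    rw [norm_pow, norm_pow, Complex.norm_exp_ofReal_mul_I, one_pow]
    exact pow_lt_one₀ (norm_nonneg _) (h3.trans_lt h4) (NeZero.ne p)

instance : SimplyConnectedSpace (InnerCover p q) :=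
  have : ContractibleSpace (InnerCover p q) := starConvex_innerCover.contractibleSpace
    ⟨0, by simp [InnerCover, NeZero.ne p]⟩
  inferInstance

instance : SimplyConnectedSpace (OuterCover p q) :=
  have : ContractibleSpace (OuterCover p q) := starConvex_outerCover.contractibleSpace
    ⟨(0, 0, 3 / 2), by norm_num [OuterCover]⟩
  inferInstance

theorem notMem_torusCurve_of_norm {x : Space} (h : 1 < ‖meridian x‖) : x ∉ torusCurve p q := by
  refine notMem_torusCurve fun h' => ?_
  have h1 : ‖direction x‖ ^ q = ‖meridian x‖ ^ p := by rw [← norm_pow, h', norm_pow]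
  have h2 : ‖direction x‖ ^ q ≤ 1 := pow_le_one₀ (norm_nonneg _) (norm_direction_le x)
  exact (one_lt_pow₀ h (NeZero.ne p)).not_ge (h1 ▸ h2)

variable (p q) in
/-- The covering projection of the inner part. -/
noncomputable def innerMap : C(InnerCover p q, ((torusCurve p q)ᶜ : Set Space)) where
  toFun s := ⟨revolve (exp (s.1.1 * I)) (halfRoot p * s.1.2), by
    refine notMem_torusCurve ?_
    rw [direction_revolve (Complex.norm_exp_ofReal_mul_I _) (innerCover_re s.2),
      meridian_revolve (Complex.norm_exp_ofReal_mul_I _) (by linarith [innerCover_re s.2]),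
      mul_pow, halfRoot_pow, neg_one_mul, Ne, ← add_eq_zero_iff_eq_neg]
    exact s.2.2⟩
  continuous_toFun := by
    refine Continuous.subtype_mk ?_ _
    fun_prop

variable (p q) in
/-- The covering projection of the outer part. -/
noncomputable def outerMap : C(OuterCover p q, ((torusCurve p q)ᶜ : Set Space)) where
  toFun s := ⟨revolve (exp (s.1.1 * I)) (halfRoot p * polar s.1.2.1 s.1.2.2), by
    have h1 := meridian_revolve (Complex.norm_exp_ofReal_mul_I s.1.1) (outerCover_re s.2)
    have h2 := outerCover_norm s.2
    rcases s.2.1.eq_or_lt with h | h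
    · refine notMem_torusCurve ?_
      rw [direction_revolve (Complex.norm_exp_ofReal_mul_I _)
        (neg_one_le_re_of_norm_le (h2.trans h.symm).le), h1,
        mul_pow, halfRoot_pow, neg_one_mul, Ne, ← add_eq_zero_iff_eq_neg, ← h]
      simpa [polar] using s.2.2.2 h.symm
    · refine notMem_torusCurve_of_norm ?_
      rwa [h1, h2]⟩
  continuous_toFun := by
    refine Continuous.subtype_mk ?_ _
    fun_prop

theorem meridian_outerMap (s : OuterCover p q) :
    meridian (outerMap p q s) = halfRoot p * polar s.1.2.1 s.1.2.2 :=
  meridian_revolve (Complex.norm_exp_ofReal_mul_I s.1.1) (outerCover_re s.2)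

theorem meridian_innerMap (s : InnerCover p q) :
    meridian (innerMap p q s) = halfRoot p * s.1.2 :=
  meridian_revolve (Complex.norm_exp_ofReal_mul_I s.1.1) (by linarith [innerCover_re s.2])

theorem direction_innerMap (s : InnerCover p q) :
    direction (innerMap p q s) = exp (s.1.1 * I) :=
  direction_revolve (Complex.norm_exp_ofReal_mul_I s.1.1) (innerCover_re s.2)

theorem innerMap_innerShift (s : InnerCover p q) : innerMap p q (innerShift s) = innerMap p q s := by
  apply Subtype.ext
  simp only [innerMap, innerShift, ContinuousMap.coe_mk, exp_two_pi_shift]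

/-- The deck transformations of the outer covering. -/
noncomputable def outerShift (k l : ℤ) : C(OuterCover p q, OuterCover p q) where
  toFun s := ⟨(s.1.1 + 2 * Real.pi * k, s.1.2.1 + 2 * Real.pi * l, s.1.2.2), s.2.1, s.2.2.1, by
    dsimp only
    rw [exp_two_pi_shift, exp_two_pi_shift]
    exact s.2.2.2⟩
  continuous_toFun := by
    refine Continuous.subtype_mk ?_ _
    fun_prop

theorem outerMap_outerShift (k l : ℤ) (s : OuterCover p q) :
    outerMap p q (outerShift k l s) = outerMap p q s := by
  apply Subtype.ext
  simp only [outerMap, outerShift, ContinuousMap.coe_mk, exp_two_pi_shift, polar]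

variable (p q) in
/-- The base point of the inner covering. -/
def innerBase : InnerCover p q := ⟨(0, 1), by norm_num [InnerCover]⟩

variable (p q) in
/-- The base point of the outer covering. -/
def outerBase : OuterCover p q := ⟨(0, 0, 1), by norm_num [OuterCover]⟩

variable (p q) in
/-- The base point of the knot complement. -/
noncomputable def basePoint : ((torusCurve p q)ᶜ : Set Space) := innerMap p q (innerBase p q)

theorem outerMap_outerBase : outerMap p q (outerBase p q) = basePoint p q := by
  apply Subtype.ext
  simp [outerMap, outerBase, basePoint, innerMap, innerBase, polar]

variable (p q) in
/-- The class of the core of the solid torus. -/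
noncomputable def coreLoop : KnotGroup (torusCurve p q) (basePoint p q) :=
  simplyConnectedLoop (innerMap p q) (s := innerBase p q) rfl
    ((innerMap_innerShift _).trans rfl)

variable (p q) in
/-- The class of a meridian of the solid torus. -/
noncomputable def meridianLoop : KnotGroup (torusCurve p q) (basePoint p q) :=
  simplyConnectedLoop (outerMap p q) (s := outerBase p q) outerMap_outerBase
    ((outerMap_outerShift 0 1 _).trans outerMap_outerBase)

/-- The curve (2πpt, 2πqt) on the torus closes up after p turns of the core in the inner cover, and
after the translation (p, q) in the outer one. That translation commutes with (0, 1), which gives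
the meridian. -/
theorem commute_coreLoop_pow : Commute (coreLoop p q ^ p) (meridianLoop p q) := by
  refine commute_simplyConnectedLoop_pow (innerMap p q) innerShift innerMap_innerShift rfl p
    (outerMap p q) (outerShift 0 1) (outerShift p q) (outerMap_outerShift _ _)
    (outerMap_outerShift _ _) outerMap_outerBase ?_
    { toFun := fun t => ⟨((2 * Real.pi * p * t : ℝ), exp ((2 * Real.pi * q * t : ℝ) * I)),
        (Complex.norm_exp_ofReal_mul_I _).le, fiber_ne_zero t⟩
      continuous_toFun := ?_
      source' := ?_
      target' := ?_ }
    { toFun := fun t => ⟨((2 * Real.pi * p * t : ℝ), (2 * Real.pi * q * t : ℝ), 1),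
        le_rfl, one_lt_two, fun _ => fiber_ne_zero t⟩
      continuous_toFun := ?_
      source' := ?_
      target' := ?_ } ?_
  · apply Subtype.ext
    simp only [outerShift, ContinuousMap.coe_mk, Prod.mk.injEq, and_true]
    constructor <;> ring
  · refine Continuous.subtype_mk ?_ _
    fun_prop
  · apply Subtype.ext
    simp [innerBase]
  · apply Subtype.ext
    have h := exp_two_pi_shift 0 q
    simp only [innerShift_iterate, innerBase, Set.Icc.coe_one]
    simp at h ⊢
    exact h
  · refine Continuous.subtype_mk ?_ _
    fun_prop
  · apply Subtype.ext
    simp [outerBase]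
  · apply Subtype.ext
    simp [outerBase, outerShift]
  · intro t
    apply Subtype.ext
    simp [innerMap, outerMap, polar]

end Regions

/-! ### Path connectedness of the knot complement. -/

section PathConnected

theorem one_lt_norm_meridian_iff (x : Space) :
    1 < ‖meridian x‖ ↔ 1 < (‖horizontal x‖ - 2) ^ 2 + x 2 ^ 2 := by
  rw [← one_lt_sq_iff₀ (norm_nonneg _), ← Complex.normSq_eq_norm_sq, Complex.normSq_apply, meridian,
    sq, sq]

theorem continuous_vec {α : Type*} [TopologicalSpace α] {a b c : α → ℝ} (ha : Continuous a)
    (hb : Continuous b) (hc : Continuous c) : Continuous fun t => (!₂[a t, b t, c t] : Space) := by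
  refine (PiLp.continuous_toLp 2 _).comp (continuous_pi fun i => ?_)
  fin_cases i
  · exact ha
  · exact hb
  · exact hc

theorem joinedIn_of_line {F : Set Space} {a b c : ℝ → ℝ} (ha : Continuous a) (hb : Continuous b)
    (hc : Continuous c) (h : ∀ t ∈ unitInterval, !₂[a t, b t, c t] ∈ F) {x y : Space}
    (hx : !₂[a 0, b 0, c 0] = x) (hy : !₂[a 1, b 1, c 1] = y) : JoinedIn F x y :=
  JoinedIn.ofLine (continuous_vec ha hb hc).continuousOn hx hy (Set.image_subset_iff.2 h)

theorem joinedIn_exterior {x : Space} (hx : 1 < ‖meridian x‖) :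
    JoinedIn {x : Space | 1 < ‖meridian x‖} x !₂[1 / 2, 0, 0] := by
  -- A vertical shift by 3 away from the plane z = 0 only increases the distance to the core. It
  -- ends at height at least 3, from where one can move to the axis and along it to the centre.
  obtain ⟨e, he, hez⟩ : ∃ e : ℝ, e ^ 2 = 9 ∧ 0 ≤ e * x 2 := by
    rcases le_total 0 (x 2) with h | h
    · exact ⟨3, by norm_num, by linarith⟩
    · exact ⟨-3, by norm_num, by linarith⟩
  have hx' := (one_lt_norm_meridian_iff x).1 hx
  have h1 : JoinedIn {x : Space | 1 < ‖meridian x‖} x !₂[x 0, x 1, x 2 + e] := by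
    refine joinedIn_of_line (a := fun _ => x 0) (b := fun _ => x 1) (c := fun t => x 2 + e * t)
      (by fun_prop) (by fun_prop) (by fun_prop) (fun t ht => ?_) ?_ (by simp)
    · rw [Set.mem_ofPred_eq, one_lt_norm_meridian_iff]
      refine hx'.trans_le (add_le_add (le_of_eq rfl) ?_)
      change x 2 ^ 2 ≤ (x 2 + e * t) ^ 2
      nlinarith [mul_nonneg hez ht.1, sq_nonneg t]
    · ext i
      fin_cases i <;> simp
  have h2 : JoinedIn {x : Space | 1 < ‖meridian x‖} !₂[x 0, x 1, x 2 + e] !₂[0, 0, x 2 + e] := by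
    refine joinedIn_of_line (a := fun t => (1 - t) * x 0) (b := fun t => (1 - t) * x 1)
      (c := fun _ => x 2 + e) (by fun_prop) (by fun_prop) (by fun_prop) (fun t ht => ?_)
      (by simp) (by simp)
    rw [Set.mem_ofPred_eq, one_lt_norm_meridian_iff]
    refine lt_of_lt_of_le ?_ (le_add_of_nonneg_left (sq_nonneg _))
    change 1 < (x 2 + e) ^ 2
    nlinarith
  have h3 : JoinedIn {x : Space | 1 < ‖meridian x‖} !₂[0, 0, x 2 + e] !₂[0, 0, 0] := by
    refine joinedIn_of_line (a := fun _ => 0) (b := fun _ => 0)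
      (c := fun t => (1 - t) * (x 2 + e)) (by fun_prop) (by fun_prop) (by fun_prop)
      (fun t ht => ?_) (by simp) (by simp)
    rw [Set.mem_ofPred_eq, one_lt_norm_meridian_iff]
    refine lt_of_lt_of_le ?_ (le_add_of_nonneg_right (sq_nonneg _))
    have : horizontal !₂[0, 0, (1 - t) * (x 2 + e)] = 0 := rfl
    rw [this]
    norm_num
  have h4 : JoinedIn {x : Space | 1 < ‖meridian x‖} !₂[0, 0, 0] !₂[1 / 2, 0, 0] := by
    refine joinedIn_of_line (a := fun t => t / 2) (b := fun _ => 0)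
      (c := fun _ => 0) (by fun_prop) (by fun_prop) (by fun_prop)
      (fun t ht => ?_) (by simp) (by simp)
    rw [Set.mem_ofPred_eq, one_lt_norm_meridian_iff]
    refine lt_of_lt_of_le ?_ (le_add_of_nonneg_right (sq_nonneg _))
    have : horizontal !₂[t / 2, 0, 0] = (t / 2 : ℝ) := rfl
    rw [this, Complex.norm_real, Real.norm_of_nonneg (by linarith [ht.1])]
    nlinarith [ht.1, ht.2]
  exact ((h1.trans h2).trans h3).trans h4

variable {p q : ℕ} [NeZero p]

theorem joined_innerMap (s : InnerCover p q) : Joined (innerMap p q s) (basePoint p q) :=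
  (PathConnectedSpace.joined s (innerBase p q)).map (innerMap p q).continuous

theorem joined_outerMap (s : OuterCover p q) : Joined (outerMap p q s) (basePoint p q) :=
  outerMap_outerBase (p := p) (q := q) ▸
    (PathConnectedSpace.joined s (outerBase p q)).map (outerMap p q).continuous

theorem exists_innerMap_eq (hpq : IsCoprime (p : ℤ) q) (x : ((torusCurve p q)ᶜ : Set Space))
    (hx : ‖meridian x‖ ≤ 1) : ∃ s, innerMap p q s = x := by
  have h1 := one_le_norm_horizontal hx
  have h2 : exp (Complex.arg (direction x) * I) = direction x := by
    simpa [norm_direction h1] using Complex.norm_mul_exp_arg_mul_I (direction x)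
  refine ⟨⟨(Complex.arg (direction x), (halfRoot p)⁻¹ * meridian x), ?_, ?_⟩, ?_⟩
  · simpa [norm_halfRoot] using hx
  · dsimp only
    rw [mul_pow, inv_pow, halfRoot_pow, h2]
    intro h
    refine x.2 (mem_torusCurve_of_pow_eq hpq (NeZero.ne p) ?_)
    linear_combination h
  · apply Subtype.ext
    simp only [innerMap, ContinuousMap.coe_mk, mul_inv_cancel_left₀ (halfRoot_ne_zero p), h2]
    exact revolve_direction_meridian h1

theorem joined_basePoint (hpq : IsCoprime (p : ℤ) q) (x : ((torusCurve p q)ᶜ : Set Space)) :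
    Joined x (basePoint p q) := by
  rcases le_or_gt ‖meridian x‖ 1 with h | h
  · obtain ⟨s, rfl⟩ := exists_innerMap_eq hpq x h
    exact joined_innerMap s
  · have h1 : JoinedIn (torusCurve p q)ᶜ x !₂[1 / 2, 0, 0] :=
      (joinedIn_exterior h).mono fun y hy => notMem_torusCurve_of_norm hy
    -- The angle is chosen so that the meridian coordinate is -3/2: the end point of the exterior
    -- path then lies in the shell.
    have h2 : (outerMap p q ⟨(0, Real.pi - Real.pi / p, 3 / 2), by norm_num [OuterCover]⟩ : Space) =
        !₂[1 / 2, 0, 0] := by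
      have : halfRoot p * polar (Real.pi - Real.pi / p) (3 / 2) = ((-3 / 2 : ℝ) : ℂ) := by
        rw [polar, halfRoot, mul_left_comm, ← Complex.exp_add, ← add_mul, ← Complex.ofReal_add,
          add_sub_cancel, Complex.exp_pi_mul_I]
        push_cast
        ring
      simp only [outerMap, ContinuousMap.coe_mk, this, revolve, Complex.ofReal_re,
        Complex.ofReal_im]
      norm_num
    have h3 := joined_outerMap (p := p) (q := q)
      ⟨(0, Real.pi - Real.pi / p, 3 / 2), by norm_num [OuterCover]⟩
    have h4 := joinedIn_iff_joined h1.source_mem h1.target_mem |>.1 h1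
    have h5 : outerMap p q ⟨(0, Real.pi - Real.pi / p, 3 / 2), by norm_num [OuterCover]⟩ =
        ⟨!₂[1 / 2, 0, 0], h1.target_mem⟩ := Subtype.ext h2
    exact h4.trans (h5 ▸ h3)

end PathConnected

/-! ### The Milnor fibre and winding along an edge of its spine. -/

section Winding

theorem one_add_re_pos {z : ℂ} (h : ‖z‖ ≤ 1) (h' : 1 + z ≠ 0) : 0 < (1 + z).re := by
  have h1 := neg_one_le_re_of_norm_le h
  rw [Complex.add_re, Complex.one_re]
  rcases h1.eq_or_lt with h2 | h2
  · refine absurd (Complex.ext ?_ ?_) h'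
    · simp [← h2]
    · have h3 : z.re * z.re + z.im * z.im ≤ 1 := by
        rw [← Complex.normSq_apply, Complex.normSq_eq_norm_sq]
        exact pow_le_one₀ (norm_nonneg _) h
      have h4 : z.im * z.im = 0 := by nlinarith [mul_self_nonneg z.im]
      simpa using h4
  · linarith

theorem inv_re_pos {z : ℂ} (h : 0 < z.re) : 0 < (z⁻¹).re := by
  rw [Complex.inv_re]
  exact div_pos h (Complex.normSq_pos.2 fun h' => by simp [h'] at h)

/-- Being the principal root of its power is a locally constant property. -/
theorem eventually_eq_cpow_iff {n : ℕ} (hn : n ≠ 0) {z : ℂ} (hz : 0 < (z ^ n).re) :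
    ∀ᶠ w in 𝓝 z, w = (w ^ n) ^ (1 / n : ℂ) ↔ z = (z ^ n) ^ (1 / n : ℂ) := by
  have hpos : ∀ᶠ w in 𝓝 z, 0 < (w ^ n).re :=
    (Complex.continuous_re.comp (continuous_pow n)).continuousAt.eventually_const_lt hz
  -- The quotient by the principal root is continuous at z and takes values in the finite set of
  -- n-th roots of unity, hence is locally constant.
  set r : ℂ → ℂ := fun w => w / (w ^ n) ^ (1 / n : ℂ) with hr
  have hroot : ∀ w : ℂ, 0 < (w ^ n).re → (w ^ n) ^ (1 / n : ℂ) ≠ 0 := fun w hw h => by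
    rw [Complex.cpow_eq_zero_iff] at h
    simp [h.1] at hw
  have hrn : ∀ w : ℂ, 0 < (w ^ n).re → r w ^ n = 1 := fun w hw => by
    have h1 : w ^ n ≠ 0 := fun h => by simp [h] at hw
    rw [hr, div_pow, one_div, Complex.cpow_nat_inv_pow _ hn, div_self h1]
  have hr1 : ∀ w : ℂ, 0 < (w ^ n).re → (w = (w ^ n) ^ (1 / n : ℂ) ↔ r w = 1) := fun w hw => by
    rw [hr, div_eq_one_iff_eq (hroot w hw)]
  have hrc : ContinuousAt r z :=
    continuousAt_id.div ((continuousAt_id.pow n).cpow continuousAt_const (Or.inl hz)) (hroot z hz)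
  have hfin : ({ζ : ℂ | ζ ^ n = 1} \ {r z}).Finite := by
    refine Set.Finite.subset (Polynomial.nthRootsFinset n (1 : ℂ)).finite_toSet fun ζ hζ => ?_
    rw [Finset.mem_coe, Polynomial.mem_nthRootsFinset (Nat.pos_of_ne_zero hn)]
    exact hζ.1
  have hev : ∀ᶠ w in 𝓝 z, r w ∉ {ζ : ℂ | ζ ^ n = 1} \ {r z} :=
    hrc.eventually (hfin.isClosed.isOpen_compl.mem_nhds fun h => h.2 rfl)
  filter_upwards [hpos, hev] with w hw hw'
  have : r w = r z := by
    by_contra h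
    exact hw' ⟨hrn w hw, h⟩
  rw [hr1 w hw, hr1 z hz, this]

/-- The complement of the complex curve `u ^ q + v ^ p = 0`. -/
def CurveComplement (p q : ℕ) : Set (ℂ × ℂ) := {y | y.1 ^ q + y.2 ^ p ≠ 0}

variable {p q : ℕ}

variable (p q) in
/-- The defining function of the curve. -/
def curveFun (y : CurveComplement p q) : ℂ := y.1.1 ^ q + y.1.2 ^ p

@[fun_prop] theorem continuous_curveFun : Continuous (curveFun p q) := by
  unfold curveFun
  fun_prop

theorem curveFun_ne_zero (y : CurveComplement p q) : curveFun p q y ≠ 0 := y.2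

/-- The infinite cyclic covering of the complement of the curve. -/
abbrev CyclicCover (p q : ℕ) : Type := LogCover (curveFun p q)

namespace CyclicCover

/-- The first coordinate of the projection to the Milnor fibre. -/
noncomputable def fst (e : CyclicCover p q) : ℂ := e.proj.1.1 * exp (-e.log / q)

/-- The second coordinate of the projection to the Milnor fibre. -/
noncomputable def snd (e : CyclicCover p q) : ℂ := e.proj.1.2 * exp (-e.log / p)

@[fun_prop] theorem continuous_fst : Continuous (fst : CyclicCover p q → ℂ) := by
  unfold fst
  fun_prop

@[fun_prop] theorem continuous_snd : Continuous (snd : CyclicCover p q → ℂ) := by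
  unfold snd
  fun_prop

theorem fst_pow [NeZero q] (e : CyclicCover p q) :
    e.fst ^ q = e.proj.1.1 ^ q / curveFun p q e.proj := by
  have : (q : ℂ) ≠ 0 := Nat.cast_ne_zero.2 (NeZero.ne q)
  rw [fst, mul_pow, ← Complex.exp_nat_mul, mul_div_cancel₀ _ this, Complex.exp_neg,
    LogCover.exp_log, div_eq_mul_inv]

theorem snd_pow [NeZero p] (e : CyclicCover p q) :
    e.snd ^ p = e.proj.1.2 ^ p / curveFun p q e.proj := by
  have : (p : ℂ) ≠ 0 := Nat.cast_ne_zero.2 (NeZero.ne p)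
  rw [snd, mul_pow, ← Complex.exp_nat_mul, mul_div_cancel₀ _ this, Complex.exp_neg,
    LogCover.exp_log, div_eq_mul_inv]

theorem fst_pow_add_snd_pow [NeZero p] [NeZero q] (e : CyclicCover p q) :
    e.fst ^ q + e.snd ^ p = 1 := by
  rw [fst_pow, snd_pow, ← add_div]
  exact div_self e.apply_proj_ne_zero

/-- A height function on the Milnor fibre. -/
noncomputable def height (e : CyclicCover p q) : ℝ := (e.fst ^ q).re

@[fun_prop] theorem continuous_height : Continuous (height : CyclicCover p q → ℝ) := by
  unfold height
  fun_prop

theorem height_eq [NeZero p] [NeZero q] (e : CyclicCover p q) :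
    e.height = 1 - (e.snd ^ p).re := by
  rw [height, eq_sub_iff_add_eq, ← Complex.add_re, fst_pow_add_snd_pow, Complex.one_re]

variable (p q) in
/-- The part of the Milnor fibre over an open edge of its spine. -/
def edge : Set (CyclicCover p q) :=
  {e | (0 < e.height ∧ e.height < 1) ∧
    e.fst = (e.fst ^ q) ^ (1 / q : ℂ) ∧ e.snd = (e.snd ^ p) ^ (1 / p : ℂ)}

/-- For height strictly between 0 and 1 both powers have positive real part, so the choice of
principal roots, and with it membership in the edge, is locally constant. -/
theorem height_eq_of_mem_frontier_edge [NeZero p] [NeZero q] {e : CyclicCover p q}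
    (he : e ∈ frontier (edge p q)) : e.height = 0 ∨ e.height = 1 := by
  have h1 : closure (edge p q) ⊆ {e | 0 ≤ e.height ∧ e.height ≤ 1} :=
    closure_minimal (fun e h => ⟨h.1.1.le, h.1.2.le⟩)
      ((isClosed_le continuous_const continuous_height).inter
        (isClosed_le continuous_height continuous_const))
  have h2 := h1 (frontier_subset_closure he)
  by_contra! h
  have h3 : 0 < e.height := lt_of_le_of_ne h2.1 (Ne.symm h.1)
  have h4 : e.height < 1 := lt_of_le_of_ne h2.2 h.2
  have h5 := continuous_fst.continuousAt.eventually
    (eventually_eq_cpow_iff (NeZero.ne q) (z := e.fst) h3)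
  have h6 := continuous_snd.continuousAt.eventually
    (eventually_eq_cpow_iff (NeZero.ne p) (z := e.snd) (by linarith [e.height_eq]))
  have h7 := continuous_height.continuousAt.eventually_const_lt h3
  have h8 := continuous_height.continuousAt.eventually_lt_const h4
  have h9 : ∀ᶠ e' in 𝓝 e, e' ∈ edge p q ↔ e ∈ edge p q := by
    filter_upwards [h5, h6, h7, h8] with e' h5 h6 h7 h8
    simp only [edge, Set.mem_ofPred_eq, h5, h6, h7, h8, h3, h4]
  rw [frontier_eq_closure_inter_closure, Set.mem_inter_iff, mem_closure_iff_frequently,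
    mem_closure_iff_frequently] at he
  by_cases hm : e ∈ edge p q
  · exact he.2 (h9.mono fun e' h hn => hn (h.2 hm))
  · exact he.1 (h9.mono fun e' h hn => hm (h.1 hn))

/-- A function on the Milnor fibre that winds once around zero along an edge of the spine. -/
noncomputable def winding (e : CyclicCover p q) : ℂ :=
  1 + (edge p q).indicator (fun e => exp (2 * Real.pi * I * e.height) - 1) e

theorem winding_of_mem {e : CyclicCover p q} (h : e ∈ edge p q) :
    e.winding = exp (2 * Real.pi * I * e.height) := by
  rw [winding, Set.indicator_of_mem h, add_sub_cancel]

theorem winding_of_notMem {e : CyclicCover p q} (h : e ∉ edge p q) : e.winding = 1 := by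
  rw [winding, Set.indicator_of_notMem h, add_zero]

theorem winding_ne_zero (e : CyclicCover p q) : e.winding ≠ 0 := by
  by_cases h : e ∈ edge p q
  · rw [winding_of_mem h]
    exact Complex.exp_ne_zero _
  · rw [winding_of_notMem h]
    exact one_ne_zero

theorem continuous_winding [NeZero p] [NeZero q] :
    Continuous (winding : CyclicCover p q → ℂ) := by
  refine continuous_const.add (Continuous.indicator (fun e he => ?_) (by fun_prop))
  -- At heights 0 and 1 the exponential is 1, matching the constant value off the edge.
  rcases height_eq_of_mem_frontier_edge he with h | h <;> simp [h, Complex.exp_two_pi_mul_I]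

/-- A covering of the infinite cyclic covering, on which the winding function has a logarithm. -/
abbrev WindingCover (p q : ℕ) : Type := LogCover (winding : CyclicCover p q → ℂ)

theorem exp_lift (e : CyclicCover p q) (j k : ℤ) :
    exp ((edge p q).indicator (fun e => 2 * Real.pi * I * (e.height - j)) e +
      2 * Real.pi * I * k) = e.winding := by
  have hk : ∀ k : ℤ, exp (2 * Real.pi * I * k) = 1 := fun k => by
    rw [mul_comm, Complex.exp_int_mul_two_pi_mul_I]
  by_cases h : e ∈ edge p q
  · rw [Set.indicator_of_mem h, winding_of_mem h, mul_sub, Complex.exp_add, Complex.exp_sub, hk, hk,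
      div_one, mul_one]
  · rw [Set.indicator_of_notMem h, winding_of_notMem h, zero_add, hk]

/-- A map to the infinite cyclic covering lifts to the winding covering if `j` is the only possible
value among `0` and `1` of the height function on its image. -/
noncomputable def lift [NeZero p] [NeZero q] {S : Type*} [TopologicalSpace S]
    (f : C(S, CyclicCover p q)) (j : ℤ) (hj : ∀ s, (f s).height = 0 ∨ (f s).height = 1 →
      (f s).height = j) (k : ℤ) : C(S, WindingCover p q) where
  toFun s := ⟨(f s, (edge p q).indicator (fun e => 2 * Real.pi * I * (e.height - j)) (f s) +
    2 * Real.pi * I * k), exp_lift _ _ _⟩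
  continuous_toFun := by
    refine Continuous.subtype_mk (f.continuous.prodMk (Continuous.add ?_ continuous_const)) _
    have : (fun s => (edge p q).indicator (fun e => 2 * Real.pi * I * (e.height - j : ℂ)) (f s)) =
        (f ⁻¹' edge p q).indicator fun s => 2 * Real.pi * I * ((f s).height - j : ℂ) := by
      funext s
      by_cases h : f s ∈ edge p q
      · rw [Set.indicator_of_mem h, Set.indicator_of_mem (Set.mem_preimage.2 h)]
      · rw [Set.indicator_of_notMem h, Set.indicator_of_notMem (by exact h)]
    rw [this]
    refine Continuous.indicator (fun s hs => ?_) (by fun_prop)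
    have h := hj s (height_eq_of_mem_frontier_edge
      (f.continuous.frontier_preimage_subset _ hs))
    simp [h]

end CyclicCover

end Winding

/-! ### Lifting the inner and outer parts to the coverings. -/

section Lifts

variable {p q : ℕ}

theorem polar_ne_zero {b m : ℝ} (hm : 1 ≤ m) : polar b m ≠ 0 :=
  norm_ne_zero_iff.1 (by rw [norm_polar (by linarith)]; linarith)

theorem polar_pow {b m : ℝ} (hm : 1 ≤ m) (p : ℕ) :
    exp (p * Real.log m + p * b * I) = polar b m ^ p := by
  rw [polar, mul_pow, Complex.exp_add, Complex.exp_nat_mul, ← Complex.ofReal_exp,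
    Real.exp_log (by linarith), mul_assoc, Complex.exp_nat_mul]

/-- A branch of log (a + b) from a logarithm of the dominant term a; for |b| ≤ |a| the principal
logarithm used here is continuous. -/
theorem exp_add_log_one_add {a b c : ℂ} (h : exp c = a) (hab : a + b ≠ 0) (n : ℤ) :
    exp (c + Complex.log (1 + b / a) + n * (2 * Real.pi * I)) = a + b := by
  have ha : a ≠ 0 := h ▸ Complex.exp_ne_zero _
  have h1 : 1 + b / a = (a + b) / a := by rw [add_div, div_self ha]
  rw [Complex.exp_add, Complex.exp_int_mul_two_pi_mul_I, mul_one, Complex.exp_add, h, h1,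
    Complex.exp_log (div_ne_zero hab ha), mul_div_cancel₀ _ ha]

theorem one_add_div_re_pos {a b : ℂ} (hab : a + b ≠ 0) (h : ‖b‖ ≤ ‖a‖) (ha : a ≠ 0) :
    0 < (1 + b / a).re := by
  refine one_add_re_pos ?_ ?_
  · rw [norm_div]
    exact div_le_one_of_le₀ h (norm_nonneg _)
  · rw [← div_self ha, ← add_div]
    exact div_ne_zero hab ha

theorem inner_re_pos (s : InnerCover p q) : 0 < (1 + s.1.2 ^ p / exp (s.1.1 * I) ^ q).re := by
  refine one_add_div_re_pos s.2.2 ?_ (pow_ne_zero _ (Complex.exp_ne_zero _))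
  rw [norm_pow, norm_pow, Complex.norm_exp_ofReal_mul_I, one_pow]
  exact pow_le_one₀ (norm_nonneg _) s.2.1

theorem two_mem_curveComplement : ((1, 1) : ℂ × ℂ) ∈ CurveComplement p q := by
  norm_num [CurveComplement]

variable (p q) in
/-- The points of the infinite cyclic covering over the base point. -/
noncomputable def cyclicBase (n : ℤ) : CyclicCover p q :=
  ⟨(⟨(1, 1), two_mem_curveComplement⟩, Complex.log 2 + n * (2 * Real.pi * I)), by
    rw [Complex.exp_add, Complex.exp_int_mul_two_pi_mul_I, Complex.exp_log two_ne_zero]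
    norm_num [curveFun]⟩

theorem cyclicBase_fst_pow [NeZero q] (n : ℤ) : (cyclicBase p q n).fst ^ q = 1 / 2 := by
  rw [CyclicCover.fst_pow]
  norm_num [cyclicBase, curveFun, LogCover.proj]

theorem cyclicBase_snd_pow [NeZero p] (n : ℤ) : (cyclicBase p q n).snd ^ p = 1 / 2 := by
  rw [CyclicCover.snd_pow]
  norm_num [cyclicBase, curveFun, LogCover.proj]

theorem height_cyclicBase [NeZero q] (n : ℤ) : (cyclicBase p q n).height = 1 / 2 := by
  rw [CyclicCover.height, cyclicBase_fst_pow]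
  norm_num

variable [NeZero p]

/-- The comparison of the knot complement with the complement of the complex curve. -/
noncomputable def toCurveComplement (hpq : IsCoprime (p : ℤ) q) :
    C(((torusCurve p q)ᶜ : Set Space), CurveComplement p q) where
  toFun x := ⟨(direction x, (halfRoot p)⁻¹ * meridian x), by
    dsimp only [CurveComplement, Set.mem_ofPred_eq]
    rw [mul_pow, inv_pow, halfRoot_pow]
    intro h
    refine x.2 (mem_torusCurve_of_pow_eq hpq (NeZero.ne p) ?_)
    linear_combination h⟩
  continuous_toFun := by
    refine Continuous.subtype_mk ?_ _
    fun_prop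

theorem toCurveComplement_innerMap (hpq : IsCoprime (p : ℤ) q) (s : InnerCover p q) :
    (toCurveComplement hpq (innerMap p q s) : ℂ × ℂ) = (exp (s.1.1 * I), s.1.2) := by
  simp only [toCurveComplement, ContinuousMap.coe_mk, direction_innerMap, meridian_innerMap,
    inv_mul_cancel_left₀ (halfRoot_ne_zero p)]

theorem toCurveComplement_outerMap (hpq : IsCoprime (p : ℤ) q) (s : OuterCover p q) :
    (toCurveComplement hpq (outerMap p q s) : ℂ × ℂ) =
      (direction (outerMap p q s), polar s.1.2.1 s.1.2.2) := by
  simp only [toCurveComplement, ContinuousMap.coe_mk, meridian_outerMap,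
    inv_mul_cancel_left₀ (halfRoot_ne_zero p)]

theorem outer_add_ne_zero (hpq : IsCoprime (p : ℤ) q) (s : OuterCover p q) :
    polar s.1.2.1 s.1.2.2 ^ p + direction (outerMap p q s) ^ q ≠ 0 := by
  have h := (toCurveComplement hpq (outerMap p q s)).2
  rw [toCurveComplement_outerMap] at h
  rw [add_comm]
  exact h

theorem outer_re_pos (hpq : IsCoprime (p : ℤ) q) (s : OuterCover p q) :
    0 < (1 + direction (outerMap p q s) ^ q / polar s.1.2.1 s.1.2.2 ^ p).re := by
  refine one_add_div_re_pos (outer_add_ne_zero hpq s) ?_ (pow_ne_zero _ (polar_ne_zero s.2.1))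
  rw [norm_pow, norm_pow, norm_polar (zero_le_one.trans s.2.1)]
  exact (pow_le_one₀ (norm_nonneg _) (norm_direction_le _)).trans (one_le_pow₀ s.2.1)

/-- The lifts of the inner part to the infinite cyclic covering. -/
noncomputable def innerCyclic (hpq : IsCoprime (p : ℤ) q) (n : ℤ) :
    C(InnerCover p q, CyclicCover p q) where
  toFun s := ⟨(toCurveComplement hpq (innerMap p q s), q * s.1.1 * I +
      Complex.log (1 + s.1.2 ^ p / exp (s.1.1 * I) ^ q) + n * (2 * Real.pi * I)), by
    dsimp only
    rw [curveFun, toCurveComplement_innerMap]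
    exact exp_add_log_one_add (by rw [mul_assoc, Complex.exp_nat_mul]) s.2.2 n⟩
  continuous_toFun := by
    refine Continuous.subtype_mk (Continuous.prodMk (by fun_prop) ?_) _
    refine Continuous.add (Continuous.add (by fun_prop) (Continuous.clog ?_ fun s =>
      Or.inl (inner_re_pos s))) continuous_const
    exact continuous_const.add (Continuous.div (by fun_prop) (by fun_prop) fun s =>
      pow_ne_zero _ (Complex.exp_ne_zero _))

/-- The lifts of the outer part to the infinite cyclic covering. -/
noncomputable def outerCyclic (hpq : IsCoprime (p : ℤ) q) (n : ℤ) :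
    C(OuterCover p q, CyclicCover p q) where
  toFun s := ⟨(toCurveComplement hpq (outerMap p q s), p * Real.log s.1.2.2 + p * s.1.2.1 * I +
      Complex.log (1 + direction (outerMap p q s) ^ q / polar s.1.2.1 s.1.2.2 ^ p) +
        n * (2 * Real.pi * I)), by
    dsimp only
    rw [curveFun, toCurveComplement_outerMap, add_comm (_ ^ q)]
    exact exp_add_log_one_add (polar_pow s.2.1 p) (outer_add_ne_zero hpq s) n⟩
  continuous_toFun := by
    refine Continuous.subtype_mk (Continuous.prodMk (by fun_prop) ?_) _
    refine Continuous.add (Continuous.add (Continuous.add (continuous_const.mul ?_) (by fun_prop))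
      (Continuous.clog ?_ fun s => Or.inl (outer_re_pos hpq s))) continuous_const
    · exact Complex.continuous_ofReal.comp (Continuous.log (by fun_prop) fun s =>
        (zero_lt_one.trans_le s.2.1).ne')
    · exact continuous_const.add (Continuous.div (by fun_prop) (by fun_prop) fun s =>
        pow_ne_zero _ (polar_ne_zero s.2.1))

theorem innerCyclic_proj (hpq : IsCoprime (p : ℤ) q) (n : ℤ) (s : InnerCover p q) :
    (innerCyclic hpq n s).proj = toCurveComplement hpq (innerMap p q s) := rfl

theorem innerCyclic_log (hpq : IsCoprime (p : ℤ) q) (n : ℤ) (s : InnerCover p q) :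
    (innerCyclic hpq n s).log = q * s.1.1 * I +
      Complex.log (1 + s.1.2 ^ p / exp (s.1.1 * I) ^ q) + n * (2 * Real.pi * I) := rfl

theorem outerCyclic_proj (hpq : IsCoprime (p : ℤ) q) (n : ℤ) (s : OuterCover p q) :
    (outerCyclic hpq n s).proj = toCurveComplement hpq (outerMap p q s) := rfl

theorem outerCyclic_log (hpq : IsCoprime (p : ℤ) q) (n : ℤ) (s : OuterCover p q) :
    (outerCyclic hpq n s).log = p * Real.log s.1.2.2 + p * s.1.2.1 * I +
      Complex.log (1 + direction (outerMap p q s) ^ q / polar s.1.2.1 s.1.2.2 ^ p) +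
        n * (2 * Real.pi * I) := rfl

variable [NeZero q]

/-- Inside, u ^ q dominates, so u ^ q / (u ^ q + v ^ p) is the inverse of a number with positive
real part. Thus inner lifts avoid the vertices of height 0; symmetrically, outer lifts avoid height
1. -/
theorem height_innerCyclic_pos (hpq : IsCoprime (p : ℤ) q) (n : ℤ) (s : InnerCover p q) :
    0 < (innerCyclic hpq n s).height := by
  have h : (innerCyclic hpq n s).fst ^ q = (1 + s.1.2 ^ p / exp (s.1.1 * I) ^ q)⁻¹ := by
    rw [CyclicCover.fst_pow, curveFun]
    rw [innerCyclic_proj, toCurveComplement_innerMap]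
    have h1 : exp (s.1.1 * I) ^ q ≠ 0 := pow_ne_zero _ (Complex.exp_ne_zero _)
    rw [← div_self h1, ← add_div, inv_div]
  rw [CyclicCover.height, h]
  exact inv_re_pos (inner_re_pos s)

theorem height_outerCyclic_lt (hpq : IsCoprime (p : ℤ) q) (n : ℤ) (s : OuterCover p q) :
    (outerCyclic hpq n s).height < 1 := by
  have h : (outerCyclic hpq n s).snd ^ p =
      (1 + direction (outerMap p q s) ^ q / polar s.1.2.1 s.1.2.2 ^ p)⁻¹ := by
    rw [CyclicCover.snd_pow, curveFun]
    rw [outerCyclic_proj, toCurveComplement_outerMap]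
    have h1 : polar s.1.2.1 s.1.2.2 ^ p ≠ 0 := pow_ne_zero _ (polar_ne_zero s.2.1)
    rw [← div_self h1, ← add_div, inv_div, add_comm (_ ^ p)]
  rw [CyclicCover.height_eq, h]
  linarith [inv_re_pos (outer_re_pos hpq s)]

/-- The lifts of the inner part to the winding covering. -/
noncomputable def innerLift (hpq : IsCoprime (p : ℤ) q) (n k : ℤ) :
    C(InnerCover p q, CyclicCover.WindingCover p q) :=
  CyclicCover.lift (innerCyclic hpq n) 1 (fun s hs => by
    have := height_innerCyclic_pos hpq n s
    rcases hs with h | h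
    · exact absurd h this.ne'
    · simpa using h) k

/-- The lifts of the outer part to the winding covering. -/
noncomputable def outerLift (hpq : IsCoprime (p : ℤ) q) (n k : ℤ) :
    C(OuterCover p q, CyclicCover.WindingCover p q) :=
  CyclicCover.lift (outerCyclic hpq n) 0 (fun s hs => by
    have := height_outerCyclic_lt hpq n s
    rcases hs with h | h
    · simpa using h
    · exact absurd h this.ne) k

theorem exp_div_eq_cpow_iff (m : ℕ) [NeZero m] (n : ℤ) :
    1 * exp (-(Complex.log 2 + n * (2 * Real.pi * I)) / m) = (1 / 2 : ℂ) ^ (1 / m : ℂ) ↔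
      (m : ℤ) ∣ n := by
  have hm : (m : ℂ) ≠ 0 := Nat.cast_ne_zero.2 (NeZero.ne m)
  have h2 : (2 * Real.pi * I : ℂ) ≠ 0 := Complex.two_pi_I_ne_zero
  have hl : Complex.log (1 / 2) = -Complex.log 2 := by
    rw [one_div, Complex.log_inv]
    have : Complex.arg 2 = 0 := Complex.ofNat_arg
    rw [this]
    exact Real.pi_pos.ne
  rw [one_mul, Complex.cpow_def_of_ne_zero (by norm_num), hl, Complex.exp_eq_exp_iff_exists_int]
  constructor
  · rintro ⟨k, hk⟩
    refine ⟨-k, ?_⟩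
    have : ((n : ℂ) + m * k) * (2 * Real.pi * I) = 0 := by
      field_simp at hk
      linear_combination -hk
    have := (mul_eq_zero.1 this).resolve_right h2
    have : n + m * k = 0 := by exact_mod_cast this
    linarith
  · rintro ⟨k, rfl⟩
    refine ⟨-k, ?_⟩
    push_cast
    field_simp
    ring

/-- Changing the sheet n multiplies the fibre coordinates by roots of unity depending on n mod q and
n mod p, so n labels an edge of the bipartite graph and only label 0 is the chosen edge. -/
theorem cyclicBase_mem_edge_iff (n : ℤ) :
    cyclicBase p q n ∈ CyclicCover.edge p q ↔ (q : ℤ) ∣ n ∧ (p : ℤ) ∣ n := by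
  rw [CyclicCover.edge, Set.mem_ofPred_eq, height_cyclicBase, cyclicBase_fst_pow,
    cyclicBase_snd_pow, ← exp_div_eq_cpow_iff q, ← exp_div_eq_cpow_iff p]
  exact ⟨fun h => h.2, fun h => ⟨by norm_num, h⟩⟩

end Lifts

/-! ### The core and the meridian do not commute. -/

section NotCommute

variable {p q : ℕ} [NeZero p]

theorem innerCyclic_innerBase (hpq : IsCoprime (p : ℤ) q) (n : ℤ) :
    innerCyclic hpq n (innerBase p q) = cyclicBase p q n := by
  refine LogCover.ext (Subtype.ext ?_) ?_
  · rw [innerCyclic_proj, toCurveComplement_innerMap]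
    simp [innerBase, cyclicBase, LogCover.proj]
  · rw [innerCyclic_log]
    simp [innerBase, cyclicBase, LogCover.log, one_add_one_eq_two]

theorem innerCyclic_innerShift (hpq : IsCoprime (p : ℤ) q) (n : ℤ) :
    innerCyclic hpq n (innerShift (innerBase p q)) = cyclicBase p q (n + q) := by
  refine LogCover.ext (Subtype.ext ?_) ?_
  · rw [innerCyclic_proj, innerMap_innerShift, toCurveComplement_innerMap]
    simp [innerBase, cyclicBase, LogCover.proj]
  · rw [innerCyclic_log]
    simp [innerShift, innerBase, cyclicBase, LogCover.log, one_add_one_eq_two,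
      Complex.exp_two_pi_mul_I]
    ring

theorem direction_outerMap_outerBase :
    direction (outerMap p q (outerBase p q)) = 1 := by
  rw [outerMap_outerBase, basePoint, direction_innerMap]
  simp [innerBase]

theorem outerCyclic_outerBase (hpq : IsCoprime (p : ℤ) q) (n : ℤ) :
    outerCyclic hpq n (outerBase p q) = cyclicBase p q n := by
  refine LogCover.ext (Subtype.ext ?_) ?_
  · rw [outerCyclic_proj, toCurveComplement_outerMap, direction_outerMap_outerBase]
    simp [outerBase, cyclicBase, LogCover.proj, polar]
  · rw [outerCyclic_log, direction_outerMap_outerBase]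
    simp [outerBase, cyclicBase, LogCover.log, one_add_one_eq_two, polar]

theorem outerCyclic_outerShift (hpq : IsCoprime (p : ℤ) q) (n : ℤ) :
    outerCyclic hpq n (outerShift 0 1 (outerBase p q)) = cyclicBase p q (n + p) := by
  refine LogCover.ext (Subtype.ext ?_) ?_
  · rw [outerCyclic_proj, outerMap_outerShift, toCurveComplement_outerMap,
      direction_outerMap_outerBase]
    simp [outerBase, cyclicBase, LogCover.proj, polar]
  · rw [outerCyclic_log, outerMap_outerShift, direction_outerMap_outerBase]
    simp [outerShift, outerBase, cyclicBase, LogCover.log, one_add_one_eq_two, polar,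
      Complex.exp_two_pi_mul_I]
    ring

variable [NeZero q]

theorem edge_indicator_cyclicBase (n j : ℤ) (h : ¬((q : ℤ) ∣ n ∧ (p : ℤ) ∣ n)) :
    (CyclicCover.edge p q).indicator (fun e => 2 * Real.pi * I * (e.height - j : ℂ))
      (cyclicBase p q n) = 0 :=
  Set.indicator_of_notMem (by rwa [cyclicBase_mem_edge_iff]) _

theorem edge_indicator_cyclicBase_zero (j : ℤ) :
    (CyclicCover.edge p q).indicator (fun e => 2 * Real.pi * I * (e.height - j : ℂ))
      (cyclicBase p q 0) = 2 * Real.pi * I * (1 / 2 - j) := by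
  rw [Set.indicator_of_mem (by simp [cyclicBase_mem_edge_iff]), height_cyclicBase]
  norm_num

theorem lift_proj {S : Type*} [TopologicalSpace S]
    (f : C(S, CyclicCover p q)) (j : ℤ) (hj : ∀ s, (f s).height = 0 ∨ (f s).height = 1 →
      (f s).height = j) (k : ℤ) (s : S) : (CyclicCover.lift f j hj k s).proj = f s := rfl

theorem lift_log {S : Type*} [TopologicalSpace S]
    (f : C(S, CyclicCover p q)) (j : ℤ) (hj : ∀ s, (f s).height = 0 ∨ (f s).height = 1 →
      (f s).height = j) (k : ℤ) (s : S) : (CyclicCover.lift f j hj k s).log =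
    (CyclicCover.edge p q).indicator (fun e => 2 * Real.pi * I * (e.height - j : ℂ)) (f s) +
      2 * Real.pi * I * k := rfl

theorem not_commute_coreLoop_meridianLoop (hpq : IsCoprime (p : ℤ) q) (hp : p ≠ 1) (hq : q ≠ 1) :
    ¬ Commute (coreLoop p q) (meridianLoop p q) := by
  intro h
  have hpq' : ¬ (p : ℤ) ∣ q := fun h => hp <| by
    simpa [Int.isUnit_iff_natAbs_eq] using hpq.isUnit_of_dvd' dvd_rfl h
  have hqp : ¬ (q : ℤ) ∣ p := fun h => hq <| by
    simpa [Int.isUnit_iff_natAbs_eq] using hpq.isUnit_of_dvd' h dvd_rfl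
  set α : Path (innerBase p q) (innerShift (innerBase p q)) := PathConnectedSpace.somePath _ _
  set β : Path (outerBase p q) (outerShift 0 1 (outerBase p q)) := PathConnectedSpace.somePath _ _
  set a : Path (basePoint p q) (basePoint p q) :=
    (α.map (innerMap p q).continuous).cast rfl (innerMap_innerShift _).symm
  set b : Path (basePoint p q) (basePoint p q) :=
    (β.map (outerMap p q).continuous).cast outerMap_outerBase.symm
      ((outerMap_outerShift 0 1 _).trans outerMap_outerBase).symm
  -- Products compose from right to left, so the product of core and meridian traverses the meridian
  -- first.
  have hab : (b.trans a).Homotopic (a.trans b) := Quotient.exact h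
  have hq0 : ¬((q : ℤ) ∣ q ∧ (p : ℤ) ∣ q) := fun h => hpq' h.2
  have hp0 : ¬((q : ℤ) ∣ p ∧ (p : ℤ) ∣ p) := fun h => hqp h.1
  -- At the midpoint of the edge the outer logarithm is 2πi(1/2 - 0) and the inner one 2πi(1/2 - 1).
  -- The shift k = 1 makes them agree, and this discrepancy survives to the end points.
  have hb : outerLift hpq 0 0 (outerBase p q) = innerLift hpq 0 1 (innerBase p q) := by
    refine LogCover.ext ?_ ?_
    · rw [outerLift, innerLift, lift_proj, lift_proj, outerCyclic_outerBase, innerCyclic_innerBase]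
    · rw [outerLift, innerLift, lift_log, lift_log, outerCyclic_outerBase, innerCyclic_innerBase,
        edge_indicator_cyclicBase_zero, edge_indicator_cyclicBase_zero]
      push_cast
      ring
  have hba : outerLift hpq 0 0 (outerShift 0 1 (outerBase p q)) =
      innerLift hpq p 0 (innerBase p q) := by
    refine LogCover.ext ?_ ?_
    · rw [outerLift, innerLift, lift_proj, lift_proj, outerCyclic_outerShift,
        innerCyclic_innerBase, zero_add]
    · rw [outerLift, innerLift, lift_log, lift_log, outerCyclic_outerShift, innerCyclic_innerBase,
        zero_add, edge_indicator_cyclicBase _ _ hp0, edge_indicator_cyclicBase _ _ hp0]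
  have hab' : innerLift hpq 0 1 (innerShift (innerBase p q)) =
      outerLift hpq q 1 (outerBase p q) := by
    refine LogCover.ext ?_ ?_
    · rw [outerLift, innerLift, lift_proj, lift_proj, innerCyclic_innerShift,
        outerCyclic_outerBase, zero_add]
    · rw [outerLift, innerLift, lift_log, lift_log, innerCyclic_innerShift, outerCyclic_outerBase,
        zero_add, edge_indicator_cyclicBase _ _ hq0, edge_indicator_cyclicBase _ _ hq0]
  have key := LogCover.eq_of_homotopic continuous_curveFun curveFun_ne_zero
    CyclicCover.continuous_winding CyclicCover.winding_ne_zero (hab.map (toCurveComplement hpq))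
    ((β.map (outerLift hpq 0 0).continuous).trans
      ((α.map (innerLift hpq p 0).continuous).cast hba rfl))
    (((α.map (innerLift hpq 0 1).continuous).cast hb hab'.symm).trans
      (β.map (outerLift hpq q 1).continuous)) ?_ ?_
  · have h1 : LogCover.log (innerLift hpq p 0 (innerShift (innerBase p q))) =
      LogCover.log (outerLift hpq q 1 (outerShift 0 1 (outerBase p q))) := by rw [key]
    -- The common end label p + q is off the chosen edge, so the logarithms there are just 2πi k,
    -- with k = 0 and k = 1.
    have hs : ¬((q : ℤ) ∣ p + q ∧ (p : ℤ) ∣ p + q) := fun h => hqp ((dvd_add_left dvd_rfl).1 h.1)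
    rw [innerLift, outerLift, lift_log, lift_log, innerCyclic_innerShift, outerCyclic_outerShift,
      add_comm (q : ℤ), edge_indicator_cyclicBase _ _ hs, edge_indicator_cyclicBase _ _ hs] at h1
    simp at h1
  · intro t
    simp only [Path.map_coe, Function.comp_apply, Path.trans_apply]
    split_ifs <;> rfl
  · intro t
    simp only [Path.map_coe, Function.comp_apply, Path.trans_apply]
    split_ifs <;> rfl

theorem exists_isGeneralizedTorsion_torusCurve (hpq : IsCoprime (p : ℤ) q) (hp : p ≠ 1)
    (hq : q ≠ 1) (b : ((torusCurve p q)ᶜ : Set Space)) :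
    ∃ x : KnotGroup (torusCurve p q) b, IsGeneralizedTorsion x := by
  obtain ⟨x, hx⟩ := IsGeneralizedTorsion.exists_of_commute_pow (NeZero.ne p)
    (commute_coreLoop_pow (p := p) (q := q)) (not_commute_coreLoop_meridianLoop hpq hp hq)
  exact ⟨_, hx.map_injective (FundamentalGroup.fundamentalGroupMulEquivOfPath
    (joined_basePoint hpq b).symm.somePath) (MulEquiv.injective _)⟩

end NotCommute

/-! ### Reversal, reflection and the trivial cases p = 1 and q = 1. -/

theorem torusCurve_neg_neg (p q : ℤ) : torusCurve (-p) (-q) = torusCurve p q := by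
  ext x
  constructor <;>
  · rintro ⟨t, rfl⟩
    exact ⟨-t, by simp⟩

/-- Cylindrical coordinates, with the horizontal plane identified with the complex plane. -/
noncomputable def cylindrical : Space ≃ₜ ℂ × ℝ where
  toFun x := (horizontal x, x 2)
  invFun y := !₂[y.1.re, y.1.im, y.2]
  left_inv x := by
    ext i
    fin_cases i <;> simp [horizontal]
  right_inv y := by
    refine Prod.ext (Complex.ext ?_ ?_) ?_ <;> simp [horizontal]
  continuous_toFun := by fun_prop
  continuous_invFun := continuous_vec (by fun_prop) (by fun_prop) (by fun_prop)

theorem knotEquiv_of_cylindrical {K L : Set Space} (h : ℂ × ℝ ≃ₜ ℂ × ℝ)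
    (hh : h '' (cylindrical '' K) = cylindrical '' L) : KnotEquiv K L :=
  ⟨(cylindrical.trans h).trans cylindrical.symm, by
    rw [show ⇑((cylindrical.trans h).trans cylindrical.symm) =
      cylindrical.symm ∘ (h ∘ cylindrical) from rfl, Set.image_comp, Set.image_comp, hh]
    exact cylindrical.toEquiv.symm_image_image L⟩

theorem cylindrical_torusCurve (p q : ℤ) : cylindrical '' torusCurve p q =
    Set.range fun t : ℝ => (((2 + Real.cos (q * t) : ℝ) * exp ((p * t : ℝ) * I), Real.sin (q * t)) :
      ℂ × ℝ) := by
  rw [torusCurve, ← Set.range_comp]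
  congr 1
  funext t
  refine Prod.ext (Complex.ext ?_ ?_) rfl
  · rw [Complex.re_ofReal_mul, Complex.exp_ofReal_mul_I_re]
    rfl
  · rw [Complex.im_ofReal_mul, Complex.exp_ofReal_mul_I_im]
    rfl

theorem cylindrical_roundCircle : cylindrical '' roundCircle =
    Set.range fun t : ℝ => ((exp (t * I), 0) : ℂ × ℝ) := by
  ext y
  constructor
  · rintro ⟨x, ⟨h1, h2⟩, rfl⟩
    have h3 : ‖horizontal x‖ = 1 := by
      rw [← pow_eq_one_iff_of_nonneg (norm_nonneg _) two_ne_zero, ← Complex.normSq_eq_norm_sq,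
        Complex.normSq_apply, ← h1, horizontal, sq, sq]
    refine ⟨Complex.arg (horizontal x), Prod.ext ?_ h2.symm⟩
    change exp (Complex.arg (horizontal x) * I) = horizontal x
    simpa [h3] using Complex.norm_mul_exp_arg_mul_I (horizontal x)
  · rintro ⟨t, rfl⟩
    refine ⟨!₂[Real.cos t, Real.sin t, 0], ?_, Prod.ext (Complex.ext ?_ ?_) ?_⟩
    · simp [roundCircle]
    · simp [cylindrical, horizontal, Complex.exp_ofReal_mul_I_re]
    · simp [cylindrical, horizontal, Complex.exp_ofReal_mul_I_im]
    · simp [cylindrical]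

theorem knotEquiv_torusCurve_neg (p q : ℤ) : KnotEquiv (torusCurve (-p) q) (torusCurve p q) := by
  refine knotEquiv_of_cylindrical
    (Complex.conjCLE.toHomeomorph.prodCongr (Homeomorph.refl ℝ)) ?_
  rw [cylindrical_torusCurve, cylindrical_torusCurve, ← Set.range_comp]
  congr 1
  funext t
  refine Prod.ext ?_ rfl
  change starRingEnd ℂ _ = _
  rw [map_mul, Complex.conj_ofReal, ← Complex.exp_conj, map_mul, Complex.conj_ofReal,
    Complex.conj_I]
  push_cast
  ring_nf

/-- The vertical shear of space along a function on the horizontal plane. -/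
noncomputable def shear (g : C(ℂ, ℝ)) : ℂ × ℝ ≃ₜ ℂ × ℝ where
  toFun y := (y.1, y.2 - g y.1)
  invFun y := (y.1, y.2 + g y.1)
  left_inv y := by simp
  right_inv y := by simp
  continuous_toFun := by fun_prop
  continuous_invFun := by fun_prop

theorem norm_div_norm_le (w : ℂ) : ‖w / ‖w‖‖ ≤ 1 := by
  rw [norm_div, Complex.norm_real, norm_norm]
  exact div_self_le_one _

/-- The factor depends on the direction only and may jump at 0, but it is bounded, so the product
still tends to 0 there. -/
theorem continuous_radial {k : ℂ → ℝ} (hk : Continuous k) :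
    Continuous fun w : ℂ => (k (w / ‖w‖) : ℂ) * w := by
  obtain ⟨C, hC⟩ := (isCompact_closedBall (0 : ℂ) 1).exists_bound_of_continuousOn hk.continuousOn
  rw [continuous_iff_continuousAt]
  intro w
  rcases eq_or_ne w 0 with rfl | hw
  · rw [ContinuousAt, mul_zero]
    refine squeeze_zero_norm (a := fun w => C * ‖w‖) (fun w => ?_) ?_
    · rw [norm_mul, Complex.norm_real]
      exact mul_le_mul_of_nonneg_right (hC _ (by simpa using norm_div_norm_le w)) (norm_nonneg _)
    · have : Continuous fun w : ℂ => C * ‖w‖ := by fun_prop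
      simpa using this.tendsto 0
  · refine ContinuousAt.mul (Complex.continuous_ofReal.continuousAt.comp
      (hk.continuousAt.comp (continuousAt_id.div ?_ ?_))) continuousAt_id
    · exact (Complex.continuous_ofReal.comp continuous_norm).continuousAt
    · simpa using hw

theorem radial_div_norm {r : ℝ} (hr : 0 < r) (w : ℂ) : (r * w) / ‖(r : ℂ) * w‖ = w / ‖w‖ := by
  rw [norm_mul, Complex.norm_real, Real.norm_of_nonneg hr.le, Complex.ofReal_mul,
    mul_div_mul_left _ _ (by exact_mod_cast hr.ne')]

/-- The rescaling of the plane by a positive function of the direction. -/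
noncomputable def radial (k : C(ℂ, ℝ)) (hk : ∀ w, 0 < k w) : ℂ ≃ₜ ℂ where
  toFun w := (k (w / ‖w‖) : ℂ) * w
  invFun w := ((k (w / ‖w‖))⁻¹ : ℝ) * w
  left_inv w := by
    have : (k (w / ‖w‖) : ℂ) ≠ 0 := by exact_mod_cast (hk _).ne'
    simp only [radial_div_norm (hk _), Complex.ofReal_inv, inv_mul_cancel_left₀ this]
  right_inv w := by
    have : (k (w / ‖w‖) : ℂ) ≠ 0 := by exact_mod_cast (hk _).ne'
    dsimp only
    rw [radial_div_norm (inv_pos.2 (hk _)), Complex.ofReal_inv, mul_inv_cancel_left₀ this]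
  continuous_toFun := continuous_radial k.continuous
  continuous_invFun := continuous_radial (k.continuous.inv₀ fun w => (hk w).ne')

theorem exp_div_norm (t : ℝ) {r : ℝ} (hr : 0 < r) :
    (r * exp (t * I)) / ‖(r : ℂ) * exp (t * I)‖ = exp (t * I) := by
  rw [radial_div_norm hr, Complex.norm_exp_ofReal_mul_I, Complex.ofReal_one, div_one]

theorem two_add_re_pow_pos {w : ℂ} (h : ‖w‖ ≤ 1) (q : ℕ) : 0 < 2 + (w ^ q).re := by
  have := neg_one_le_re_of_norm_le ((norm_pow w q).trans_le (pow_le_one₀ (norm_nonneg _) h))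
  linarith

/-- The retraction of the plane onto the unit disc. -/
noncomputable def discRetraction : C(ℂ, ℂ) where
  toFun w := w / (max 1 ‖w‖ : ℝ)
  continuous_toFun := continuous_id.div (by fun_prop) fun w => by
    exact_mod_cast (lt_of_lt_of_le one_pos (le_max_left _ _)).ne'

theorem norm_discRetraction_le (w : ℂ) : ‖discRetraction w‖ ≤ 1 := by
  change ‖w / (max 1 ‖w‖ : ℝ)‖ ≤ 1
  rw [norm_div, Complex.norm_real, Real.norm_of_nonneg (by positivity)]
  exact div_le_one_of_le₀ (le_max_right _ _) (by positivity)

theorem discRetraction_mul_exp (t : ℝ) {r : ℝ} (hr : 1 ≤ r) :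
    discRetraction (r * exp (t * I)) = exp (t * I) := by
  have h : ‖(r : ℂ) * exp (t * I)‖ = r := by
    rw [norm_mul, Complex.norm_exp_ofReal_mul_I, Complex.norm_real, mul_one,
      Real.norm_of_nonneg (by linarith)]
  have := exp_div_norm t (zero_lt_one.trans_le hr)
  change _ / ((max 1 _ : ℝ) : ℂ) = _
  rw [h] at this
  rwa [h, max_eq_right hr]

theorem exp_pow_eq (t : ℝ) (q : ℕ) : exp (t * I) ^ q = exp ((q * t : ℝ) * I) := by
  rw [← Complex.exp_nat_mul]
  push_cast
  ring_nf

/-- The curve is a graph over the angle t: height sin qt and radius 2 + cos qt. A shear removes the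
height and a radial rescaling makes the radius 1; retracting to the disc extends both functions
continuously to the plane. -/
theorem isTrivialKnot_torusCurve_one_left (q : ℕ) : IsTrivialKnot (torusCurve 1 q) := by
  set c : C(ℂ, ℝ) := ⟨fun w => 2 + (discRetraction w ^ q).re, by fun_prop⟩ with hc
  have hc0 : ∀ w, 0 < c w := fun w => two_add_re_pow_pos (norm_discRetraction_le w) q
  refine knotEquiv_of_cylindrical ((shear ⟨fun w => (discRetraction w ^ q).im, by fun_prop⟩).trans
    ((radial ⟨fun w => (c w)⁻¹, c.continuous.inv₀ fun w => (hc0 w).ne'⟩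
      fun w => inv_pos.2 (hc0 w)).prodCongr (Homeomorph.refl ℝ))) ?_
  rw [cylindrical_torusCurve, cylindrical_roundCircle, ← Set.range_comp]
  congr 1
  funext t
  have h1 : 1 ≤ 2 + Real.cos ((q : ℤ) * t) := by linarith [Real.neg_one_le_cos ((q : ℤ) * t)]
  have h2 : ((1 : ℤ) : ℝ) * t = t := by simp
  have h3 := exp_div_norm t (zero_lt_one.trans_le h1)
  have h4 : discRetraction (exp (t * I)) = exp (t * I) := by
    simpa using discRetraction_mul_exp t le_rfl
  simp only [Function.comp_apply, h2]
  refine Prod.ext ?_ ?_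
  · change (((c (_ / (‖_‖ : ℂ)))⁻¹ : ℝ) : ℂ) * _ = _
    rw [h3, hc]
    simp only [ContinuousMap.coe_mk]
    rw [h4, exp_pow_eq, Complex.exp_ofReal_mul_I_re, ← mul_assoc, ← Complex.ofReal_mul,
      Int.cast_natCast, inv_mul_cancel₀ (by simpa using (zero_lt_one.trans_le h1).ne'),
      Complex.ofReal_one, one_mul]
  · change _ - (discRetraction _ ^ q).im = 0
    rw [discRetraction_mul_exp t h1, exp_pow_eq, Complex.exp_ofReal_mul_I_im]
    simp

/-- The polynomial form of cos² + sin² = 1. It holds for all real z, so the two polynomials never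
vanish together. -/
theorem chebyshev_pell (n : ℕ) (z : ℝ) :
    (T ℝ n).eval z ^ 2 + (1 - z ^ 2) * (U ℝ (n - 1)).eval z ^ 2 = 1 := by
  induction n with
  | zero => simp
  | succ n ih =>
    have h1 : T ℝ (n + 1 : ℕ) = Polynomial.X * T ℝ n - (1 - Polynomial.X ^ 2) * U ℝ (n - 1) := by
      have := Polynomial.Chebyshev.T_eq_X_mul_T_sub_pol_U ℝ ((n : ℤ) - 1)
      rw [sub_add_cancel, show (n : ℤ) - 1 + 2 = (n + 1 : ℕ) by push_cast; ring] at this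
      exact this
    have h2 : U ℝ ((n + 1 : ℕ) - 1) = Polynomial.X * U ℝ (n - 1) + T ℝ n := by
      have := Polynomial.Chebyshev.U_eq_X_mul_U_add_T ℝ ((n : ℤ) - 1)
      rw [sub_add_cancel] at this
      rw [← this]
      congr 1
      push_cast
      ring
    rw [h1, h2]
    simp only [Polynomial.eval_sub, Polynomial.eval_mul, Polynomial.eval_add, Polynomial.eval_X,
      Polynomial.eval_one, Polynomial.eval_pow]
    linear_combination ih

theorem exists_chebyshev (p : ℕ) : ∃ f g : ℝ → ℝ, Continuous f ∧ Continuous g ∧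
    (∀ z, f z ^ 2 + (1 - z ^ 2) * g z ^ 2 = 1) ∧ (∀ s, f (Real.cos s) = Real.cos (p * s)) ∧
      ∀ s, g (Real.cos s) * Real.sin s = Real.sin (p * s) := by
  refine ⟨fun z => (T ℝ p).eval z, fun z => (U ℝ (p - 1)).eval z, by fun_prop, by fun_prop,
    chebyshev_pell p, fun s => ?_, fun s => ?_⟩
  · dsimp only
    rw [Polynomial.Chebyshev.T_real_cos, Int.cast_natCast]
  · dsimp only
    rw [Polynomial.Chebyshev.U_real_cos]
    push_cast
    ring_nf

/-- An affine map of each horizontal plane. -/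
noncomputable def levelAffine (m l : C(ℝ, ℂ)) (hl : ∀ z, l z ≠ 0) : ℂ × ℝ ≃ₜ ℂ × ℝ where
  toFun y := ((y.1 - m y.2) / l y.2, y.2)
  invFun y := (y.1 * l y.2 + m y.2, y.2)
  left_inv y := by simp [div_mul_cancel₀ _ (hl y.2)]
  right_inv y := by simp [mul_div_cancel_right₀ _ (hl y.2)]
  continuous_toFun := ((continuous_fst.sub (m.continuous.comp continuous_snd)).div
    (l.continuous.comp continuous_snd) fun y => hl y.2).prodMk continuous_snd
  continuous_invFun := by fun_prop

/-- The rotation of space about the first coordinate axis. -/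
noncomputable def tilt : ℂ × ℝ ≃ₜ ℂ × ℝ where
  toFun y := (y.1.re + y.2 * I, y.1.im)
  invFun y := (y.1.re + y.2 * I, y.1.im)
  left_inv y := Prod.ext (Complex.ext (by simp) (by simp)) (by simp)
  right_inv y := Prod.ext (Complex.ext (by simp) (by simp)) (by simp)
  continuous_toFun := by fun_prop
  continuous_invFun := by fun_prop

/-- A level z = sin t meets the curve at t and π - t, where cos t changes sign. The horizontal
position has the form m(z) + cos t · l(z) with m, l polynomial in z, so an affine change in each
level leaves (cos t, sin t), a circle in a vertical plane. -/
theorem isTrivialKnot_torusCurve_one_right (p : ℕ) : IsTrivialKnot (torusCurve p 1) := by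
  obtain ⟨f, g, hf, hg, hfg, hfc, hgs⟩ := exists_chebyshev p
  set l : C(ℝ, ℂ) := ⟨fun z => I ^ p * (f z - 2 * I * g z), by
    fun_prop⟩ with hl
  set m : C(ℝ, ℂ) := ⟨fun z => I ^ p * (2 * f z -
    I * (1 - z ^ 2) * g z), by fun_prop⟩ with hm
  -- The Pell identity keeps l invertible at every level, including z = ±1 where the two points
  -- merge.
  have hl0 : ∀ z, l z ≠ 0 := fun z h => by
    have h1 := (mul_eq_zero.1 h).resolve_left (pow_ne_zero _ Complex.I_ne_zero)
    have h2 : f z = 0 := by simpa using congrArg Complex.re h1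
    have h3 : g z = 0 := by simpa using congrArg Complex.im h1
    have := hfg z
    rw [h2, h3] at this
    norm_num at this
  refine knotEquiv_of_cylindrical ((levelAffine m l hl0).trans tilt) ?_
  rw [cylindrical_torusCurve, cylindrical_roundCircle, ← Set.range_comp]
  congr 1
  funext t
  have key : ((2 + Real.cos t : ℝ) : ℂ) * exp ((p * t : ℝ) * I) - m (Real.sin t) =
      Real.cos t * l (Real.sin t) := by
    have hc : Real.cos (Real.pi / 2 - t) = Real.sin t := Real.cos_pi_div_two_sub t
    have hs : Real.sin (Real.pi / 2 - t) = Real.cos t := Real.sin_pi_div_two_sub t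
    -- The complementary angle turns the level sin t into cos s, the argument of the Chebyshev
    -- identities, at the cost of the factor I ^ p.
    set s := Real.pi / 2 - t with hs'
    have hT : f (Real.sin t) = Real.cos (p * s) := by
      rw [← hc, hfc]
    have hU : g (Real.sin t) * Real.cos t = Real.sin (p * s) := by
      rw [← hc, ← hs, hgs]
    have he : exp ((p * t : ℝ) * I) = I ^ p * (Real.cos (p * s) - Real.sin (p * s) * I) := by
      have h1 : exp ((p * t : ℝ) * I) = exp (Real.pi / 2 * I) ^ p * exp ((-(p * s) : ℝ) * I) := by
        rw [← Complex.exp_nat_mul, ← Complex.exp_add, hs']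
        push_cast
        ring_nf
      rw [h1, Complex.exp_pi_div_two_mul_I]
      congr 1
      apply Complex.ext
      · rw [Complex.exp_ofReal_mul_I_re, Real.cos_neg]
        simp [-Complex.ofReal_cos, -Complex.ofReal_sin]
      · rw [Complex.exp_ofReal_mul_I_im, Real.sin_neg]
        simp [-Complex.ofReal_cos, -Complex.ofReal_sin]
    have h4 : (1 - (Real.sin t : ℂ) ^ 2) = (Real.cos t : ℂ) * Real.cos t := by
      rw [← Complex.ofReal_mul, ← sq, Real.cos_sq']
      push_cast
      ring
    have hU' : (g (Real.sin t) : ℂ) * Real.cos t = Real.sin (p * s) := by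
      rw [← Complex.ofReal_mul, hU]
    rw [hm, hl, he]
    simp only [ContinuousMap.coe_mk]
    rw [hT, h4]
    push_cast [-Complex.ofReal_cos, -Complex.ofReal_sin]
    linear_combination (I ^ p * I * (Real.cos t + 2)) * hU'
  have key' : (levelAffine m l hl0) (((2 + Real.cos t : ℝ) : ℂ) * exp ((p * t : ℝ) * I),
      Real.sin t) = ((Real.cos t : ℂ), Real.sin t) := by
    refine Prod.ext ?_ rfl
    change (_ - m (Real.sin t)) / l (Real.sin t) = _
    rw [key, mul_div_cancel_right₀ _ (hl0 _)]
  simp only [Function.comp_apply, Homeomorph.trans_apply, Int.cast_one, one_mul, Int.cast_natCast]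
  rw [key']
  refine Prod.ext (Complex.ext ?_ ?_) ?_
  · rw [Complex.exp_ofReal_mul_I_re]
    simp [tilt, -Complex.ofReal_cos, -Complex.ofReal_sin]
  · rw [Complex.exp_ofReal_mul_I_im]
    simp [tilt, -Complex.ofReal_cos, -Complex.ofReal_sin]
  · simp [tilt, -Complex.ofReal_cos, -Complex.ofReal_sin]

/-! ### Reduction to natural parameters and conclusion. -/

theorem exists_knotEquiv_torusCurve_natCast {p q : ℤ} (hpq : IsCoprime p q) :
    ∃ m n : ℕ, IsCoprime (m : ℤ) n ∧ KnotEquiv (torusCurve p q) (torusCurve m n) := by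
  have h : ∀ (p : ℤ) (k : ℕ), IsCoprime p k → ∃ m n : ℕ, IsCoprime (m : ℤ) n ∧
      KnotEquiv (torusCurve p k) (torusCurve m n) := fun p n hc => by
    rcases Int.eq_nat_or_neg p with ⟨m, rfl | rfl⟩
    · exact ⟨m, n, hc, KnotEquiv.refl _⟩
    · exact ⟨m, n, IsCoprime.neg_left_iff _ _ |>.1 hc, knotEquiv_torusCurve_neg _ _⟩
  rcases Int.eq_nat_or_neg q with ⟨n, rfl | rfl⟩
  · exact h p n hpq
  · rw [← torusCurve_neg_neg, neg_neg]
    exact h (-p) n (by simpa using hpq.neg_neg)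

theorem corollary6 (K : Set Space) (hK : IsTorusKnot K) (hnt : ¬ IsTrivialKnot K)
    (b : (Kᶜ : Set Space)) :
    ∃ x : KnotGroup K b, IsGeneralizedTorsion x := by
  obtain ⟨p', q', hpq', h'⟩ := hK
  obtain ⟨p, q, hpq, h⟩ := exists_knotEquiv_torusCurve_natCast hpq'
  have hKT := h'.trans h
  have hnt' : ¬ IsTrivialKnot (torusCurve p q) := fun h => hnt (hKT.trans h)
  have hp1 : p ≠ 1 := fun h => by
    subst h
    exact hnt' (by exact_mod_cast isTrivialKnot_torusCurve_one_left q)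
  have hq1 : q ≠ 1 := fun h => by
    subst h
    exact hnt' (by exact_mod_cast isTrivialKnot_torusCurve_one_right p)
  -- Coprimality with 0 would force the other parameter to be 1, a case already excluded.
  have hp : NeZero p := ⟨fun h => hq1 <| by
    simpa [h, isCoprime_zero_left, Int.isUnit_iff_natAbs_eq] using hpq⟩
  have hq : NeZero q := ⟨fun h => hp1 <| by
    simpa [h, isCoprime_zero_right, Int.isUnit_iff_natAbs_eq] using hpq⟩
  exact hKT.exists_isGeneralizedTorsion (exists_isGeneralizedTorsion_torusCurve hpq hp1 hq1) b
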